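/- Positive cubature rules of degree $11$ and index $10$ on $\mathbb S^d$, $3\le d\le 23$. For a finite set $X\subset\mathbb S^d$ and weights $(w_x)_{x\in X}$, the rule $Q(f)=\sum_{x\in X}w_xf(x)$ is exact for $f$ if $Q(f)$ equals the mean of $f$ over the unit sphere $\mathbb S^d\subset\mathbb R^{d+1}$ for the surface measure. It has degree $n$ if it is exact for all polynomials in $d+1$ variables of degree at most $n$, but not for all those of degree at most $n+1$; it has index $n$ if it is exact for all homogeneous polynomials of degree $n$; it is positive if all $w_x>0$. It is $\mathcal B_{d+1}$-invariant if $X$ and $w$ are invariant under the group $\mathcal B_{d+1}$ of signed permutations of the coordinates of $\mathbb R^{d+1}$. It is rational if all $w_x$ are rational and every node is a vector with rational coordinates divided by the square root of a positive rational number. For integers $1\le k\le d+1$ and $1\le p\le d$ and real $a>0$, $a\neq1$, let $v_k=\tfrac1{\sqrt k}(1,\dots,1,0,\dots,0)\in\mathbb R^{d+1}$ with $k$ ones, and let $u_{a,p}=\tfrac1{\sqrt{a+p}}(\sqrt a,1,\dots,1,0,\dots,0)\in\mathbb R^{d+1}$ with $p$ ones. For $\lambda=(\lambda_1,\dots,\lambda_6)$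 with all $\lambda_j\ge0$, consider the rule $$ Q_{d,p,m,a,\lambda}(f)=\frac{\lambda_1}{2^{d+1}}\sum_{x\in v_{d+1}\mathcal B_{d+1}}f(x)+\frac{\lambda_2}{2(d+1)}\sum_{x\in v_1\mathcal B_{d+1}}f(x)+\frac{\lambda_3}{4\binom{d+1}2}\sum_{x\in v_2\mathcal B_{d+1}}f(x)+\frac{\lambda_4}{8\binom{d+1}3}\sum_{x\in v_3\mathcal B_{d+1}}f(x) $$ $$ \qquad+\frac{\lambda_5}{2^m\binom{d+1}m}\sum_{x\in v_m\mathcal B_{d+1}}f(x)+\frac{\lambda_6}{2^{p+1}(d+1)\binom dp}\sum_{x\in u_{a,p}\mathcal B_{d+1}}f(x), $$ where orbits with $\lambda_j=0$ are left out, and the weights of coinciding nodes are added. Call such a rule *good* if it is a positive $\mathcal B_{d+1}$-invariant rule of degree $11$ on $\mathbb S^d$ and if, moreover, keeping exactly one node of each antipodal pair of nodes, with doubled weight, gives a positive rule of index $10$ on $\mathbb S^d$. (i) Let $(d,p,m)$ be one of $(3,2,4)$, $(5,3,4)$, $(7,4,4)$, $(9,5,5)$, $(11,6,5)$, $(13,7,5)$,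 $(15,8,5)$, $(17,9,5)$, $(19,10,5)$, $(21,11,5)$, $(23,12,4)$, $(4,3,4)$, $(6,4,4)$, $(8,5,5)$, $(10,6,5)$, $(12,7,5)$, $(14,8,6)$, $(16,9,6)$, $(18,10,6)$, $(20,11,6)$, $(22,12,6)$; every $d$ with $3\le d\le 23$ occurs. Put $a=10\frac{p-1}{d-1}-1$. Then $a>0$, $a\ne1$, and there are $\lambda_1,\dots,\lambda_6\ge 0$ with $\sum_j\lambda_j=1$ and $$\lambda_6=(a+p)^5\,\frac{60\,d}{p\,a\,(a-1)^2(a+1)(d+9)(d+7)(d+5)(d+3)}$$ such that $Q_{d,p,m,a,\lambda}$ is good. If $d$ is odd, then $d=2p-1$. If $d=2p-1$, then $a=4$, and $\lambda$ can be chosen so that in addition all $\lambda_j$ are rational and the rule $Q_{d,p,m,a,\lambda}$ is rational. (ii) With $a=4$, the rule $Q_{d,p,m,a,\lambda}$ is good and rational in each of the cases - $(d,p,m)=(3,2,4)$, $\lambda=\left(\frac2{15},\frac1{15},\frac18,0,0,\frac{27}{40}\right)$; - $(d,p,m)=(7,4,4)$, $\lambda=\left(\frac{32}{315},\frac1{105},\frac2{45},0,\frac2{15},\frac{32}{45}\right)$;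 - $(d,p,m)=(21,11,5)$, $\lambda=\left(\frac{14641}{705432},\frac{61}{192192},0,\frac{405}{31616},\frac{625}{14144},\frac{16875}{18304}\right)$; - $(d,p,m)=(23,12,4)$, $\lambda=\left(0,\frac1{4095},0,0,\frac{506}{12285},\frac{11776}{12285}\right)$. (iii) Let $Q$ be the rule for $d=3$ in (ii), with nodes $y$ and weights $w_y$. For all $x\in\mathbb R^4$, $$22680\Big(\sum_{i=1}^4x_i^2\Big)^5=552960\sum_{y}w_y\langle x,y\rangle^{10},$$ and this is Schur's identity $$22680\Big(\sum_{i=1}^4x_i^2\Big)^5=9\sum_4(2x_i)^{10}+180\sum_{12}(x_i\pm x_j)^{10}+\sum_{48}(2x_i\pm x_j\pm x_k)^{10}+9\sum_8(x_1\pm x_2\pm x_3\pm x_4)^{10}.$$ Here the sums run, respectively, over $1\le i\le 4$; over $i<j$ and both signs; over distinct $i,j,k$ with $j<k$ and all signs; and over all choices of the three signs. -/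

import Mathlib

open scoped BigOperators

/-- A cubature rule on the unit sphere of `ℝⁿ`: finitely many nodes, each with a real weight
(the values of `weight` outside `nodes` play no role). -/
structure CubatureRule (n : ℕ) where
  nodes : Finset (EuclideanSpace ℝ (Fin n))
  weight : EuclideanSpace ℝ (Fin n) → ℝ

namespace CubatureRule

variable {n : ℕ}

/-- The value of the rule on the function `f`. -/
noncomputable def apply (Q : CubatureRule n) (f : EuclideanSpace ℝ (Fin n) → ℝ) : ℝ :=
  ∑ x ∈ Q.nodes, Q.weight x * f x

/-- The mean of `f` over the unit sphere of `ℝⁿ` for the surface measure. -/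
noncomputable def sphereMean (f : EuclideanSpace ℝ (Fin n) → ℝ) : ℝ :=
  ⨍ y : Metric.sphere (0 : EuclideanSpace ℝ (Fin n)) 1, f (y : EuclideanSpace ℝ (Fin n))
    ∂((MeasureTheory.volume : MeasureTheory.Measure (EuclideanSpace ℝ (Fin n))).toSphere)

/-- The rule reproduces the mean over the sphere of the polynomial `f`. -/
def IsExactFor (Q : CubatureRule n) (f : MvPolynomial (Fin n) ℝ) : Prop :=
  sphereMean (fun x => MvPolynomial.eval (fun i => x i) f) =
    Q.apply (fun x => MvPolynomial.eval (fun i => x i) f)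

/-- Degree `t`: exact for all polynomials of degree at most `t`, but not for all polynomials of
degree at most `t + 1`. -/
def IsOfDegree (Q : CubatureRule n) (t : ℕ) : Prop :=
  (∀ f : MvPolynomial (Fin n) ℝ, f.totalDegree ≤ t → Q.IsExactFor f) ∧
    ∃ f : MvPolynomial (Fin n) ℝ, f.totalDegree ≤ t + 1 ∧ ¬ Q.IsExactFor f

/-- Index `t`: exact for all homogeneous polynomials of degree `t`. -/
def IsOfIndex (Q : CubatureRule n) (t : ℕ) : Prop :=
  ∀ f : MvPolynomial (Fin n) ℝ, f.IsHomogeneous t → Q.IsExactFor f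

/-- All nodes are points of the unit sphere. -/
def OnSphere (Q : CubatureRule n) : Prop :=
  ∀ x ∈ Q.nodes, ‖x‖ = 1

/-- All weights are positive. -/
def IsPositive (Q : CubatureRule n) : Prop :=
  ∀ x ∈ Q.nodes, 0 < Q.weight x

/-- `Q'` keeps exactly one node of each antipodal pair `{x, -x}` of nodes of `Q`, with twice
the weight. -/
def IsHalfOf (Q' Q : CubatureRule n) : Prop :=
  Q'.nodes ⊆ Q.nodes ∧ (∀ x ∈ Q.nodes, -x ∈ Q.nodes) ∧
    (∀ x ∈ Q.nodes, (x ∈ Q'.nodes ↔ -x ∉ Q'.nodes)) ∧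
    ∀ x ∈ Q'.nodes, Q'.weight x = 2 * Q.weight x

/-- All weights are rational, and every node is a vector with rational coordinates divided by the
square root of a positive rational number. -/
def IsRational (Q : CubatureRule n) : Prop :=
  ∀ x ∈ Q.nodes, (∃ q : ℚ, Q.weight x = (q : ℝ)) ∧
    ∃ r : ℚ, 0 < r ∧ ∀ i, ∃ b : ℚ, x i = (b : ℝ) / Real.sqrt (r : ℝ)

end CubatureRule

/-- The element of the Weyl group of type `B` that permutes the coordinates by `σ` and multiplies
them by the signs `ε`. The group consists exactly of these maps. -/
noncomputable def signedPerm {n : ℕ} (σ : Equiv.Perm (Fin n)) (ε : Fin n → ℤˣ)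
    (x : EuclideanSpace ℝ (Fin n)) : EuclideanSpace ℝ (Fin n) :=
  WithLp.toLp 2 (fun i => ((ε i : ℤ) : ℝ) * x (σ i))

open Classical in
/-- The orbit of `x` under the Weyl group of type `B`. -/
noncomputable def orbitB {n : ℕ} (x : EuclideanSpace ℝ (Fin n)) :
    Finset (EuclideanSpace ℝ (Fin n)) :=
  (Finset.univ : Finset (Equiv.Perm (Fin n) × (Fin n → ℤˣ))).image
    (fun g => signedPerm g.1 g.2 x)

/-- The nodes are permuted by the Weyl group of type `B`, and the weights are constant on its
orbits. -/
def CubatureRule.IsInvariantB {n : ℕ} (Q : CubatureRule n) : Prop :=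
  ∀ (σ : Equiv.Perm (Fin n)) (ε : Fin n → ℤˣ), ∀ x ∈ Q.nodes,
    signedPerm σ ε x ∈ Q.nodes ∧ Q.weight (signedPerm σ ε x) = Q.weight x

/-- The point `(1/√k, …, 1/√k, 0, …, 0)` of `ℝⁿ`, with `k` nonzero coordinates. -/
noncomputable def nodeV (n k : ℕ) : EuclideanSpace ℝ (Fin n) :=
  WithLp.toLp 2 (fun i => if (i : ℕ) < k then 1 / Real.sqrt (k : ℝ) else 0)

/-- The point `(√(a/(a+p)), 1/√(a+p), …, 1/√(a+p), 0, …, 0)` of `ℝⁿ`, where `1/√(a+p)` stands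
`p` times. -/
noncomputable def nodeU (n p : ℕ) (a : ℝ) : EuclideanSpace ℝ (Fin n) :=
  WithLp.toLp 2 (fun i =>
    if (i : ℕ) = 0 then Real.sqrt (a / (a + p))
    else if (i : ℕ) ≤ p then 1 / Real.sqrt (a + p) else 0)

/-- The generators of the six orbits of nodes on the unit sphere of `ℝ^(d+1)`. -/
noncomputable def generator (d p m : ℕ) (a : ℝ) : Fin 6 → EuclideanSpace ℝ (Fin (d + 1)) :=
  ![nodeV (d + 1) (d + 1), nodeV (d + 1) 1, nodeV (d + 1) 2, nodeV (d + 1) 3,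
    nodeV (d + 1) m, nodeU (d + 1) p a]

/-- The sizes of the six orbits (for `a ≠ 1`). -/
def orbitSize (d p m : ℕ) : Fin 6 → ℕ :=
  ![2 ^ (d + 1), 2 * (d + 1), 4 * (d + 1).choose 2, 8 * (d + 1).choose 3,
    2 ^ m * (d + 1).choose m, 2 ^ (p + 1) * (d + 1) * d.choose p]

open Classical in
/-- The rule `f ↦ ∑ⱼ lamⱼ / Nⱼ · ∑_{x in the j-th orbit} f x` with `Nⱼ` the size of the `j`-th
orbit. Orbits with coefficient zero are left out; a node that lies in several of the orbits
receives the sum of its weights. -/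
noncomputable def sixOrbitRule (d p m : ℕ) (a : ℝ) (lam : Fin 6 → ℝ) : CubatureRule (d + 1) where
  nodes := (Finset.univ.filter (fun j => lam j ≠ 0)).biUnion
    (fun j => orbitB (generator d p m a j))
  weight x := ∑ j, if x ∈ orbitB (generator d p m a j) then lam j / (orbitSize d p m j : ℝ) else 0

/-- The rule is a positive rule of degree 11 on the sphere, invariant under the Weyl group of type
`B`, which reduces by antipodality to a positive rule of index 10 with half as many nodes. -/
def CubatureRule.IsPositiveInvariantOfDegreeEleven {n : ℕ} (Q : CubatureRule n) : Prop :=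
  Q.OnSphere ∧ Q.IsPositive ∧ Q.IsInvariantB ∧ Q.IsOfDegree 11 ∧
    ∃ Q' : CubatureRule n, Q'.IsHalfOf Q ∧ Q'.OnSphere ∧ Q'.IsPositive ∧ Q'.IsOfIndex 10

/-- The parameters `(d, p, m)`. -/
def parameters : List (ℕ × ℕ × ℕ) :=
  [(3, 2, 4), (5, 3, 4), (7, 4, 4), (9, 5, 5), (11, 6, 5), (13, 7, 5), (15, 8, 5), (17, 9, 5),
    (19, 10, 5), (21, 11, 5), (23, 12, 4),
    (4, 3, 4), (6, 4, 4), (8, 5, 5), (10, 6, 5), (12, 7, 5), (14, 8, 6), (16, 9, 6), (18, 10, 6),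
    (20, 11, 6), (22, 12, 6)]

/-- The parameter `a` of the sixth orbit. -/
noncomputable def parameterA (d p : ℕ) : ℝ :=
  10 * (((p : ℝ) - 1) / ((d : ℝ) - 1)) - 1

/-- The right-hand side of Schur's identity: a sum of 10th powers of `4 + 12 + 48 + 8` linear
forms in four variables. -/
def schurSum (x : Fin 4 → ℝ) : ℝ :=
  9 * ∑ i, (2 * x i) ^ 10
  + 180 * ∑ i, ∑ j ∈ Finset.Ioi i, ∑ ε ∈ ({1, -1} : Finset ℤ), (x i + ε * x j) ^ 10
  + ∑ i, ∑ j ∈ Finset.univ.erase i, ∑ k ∈ (Finset.Ioi j).erase i,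
      ∑ ε ∈ ({1, -1} : Finset ℤ), ∑ δ ∈ ({1, -1} : Finset ℤ),
        (2 * x i + ε * x j + δ * x k) ^ 10
  + 9 * ∑ ε ∈ ({1, -1} : Finset ℤ), ∑ δ ∈ ({1, -1} : Finset ℤ), ∑ η ∈ ({1, -1} : Finset ℤ),
      (x 0 + ε * x 1 + δ * x 2 + η * x 3) ^ 10

/-! Write `y_i = x_i²` and `p_k = ∑ y_i^k`, so that `p_1 = 1` on the sphere. An invariant rule and
the mean both kill monomials with an odd exponent, so up to degree 11 only the error `E(β)` on the
monomials `y^β` with `|β| ≤ 5` matters. `E` is symmetric in `β`, and `∑ y_i = 1` gives `∑_i E(β +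
e_i) = E(β)`, which eliminates every exponent equal to 1. What remains are the partitions with parts
at least 2 and total at most 5: the empty one, `(2)`, …, `(5)`, `(2,2)` and `(3,2)`. Exactness thus
reduces to the seven invariants `1, p_2, …, p_5, p_2², p_2 p_3` (`PowerSumExact.evenError_eq_zero`).
An invariant function is constant on each orbit, so these become seven equations, linear in `λ`.

At `v_k` one has `p_j = k^(1-j)`, so `p_3 - p_2²` and `p_4 - p_2 p_3` vanish there and see only the
orbit of `u`. With `p_1` inserted they are `∑_{i<j} y_i y_j (y_i - y_j)²` and the same sum with the
additional factor `y_i + y_j`. The quotient of the two equations reads `(a+1)/(a+p) = 10/(d+9)`,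
which is the stated value of `a`; the second equation then gives `λ_6`. The other five equations are
a Vandermonde system for `λ_1, …, λ_5` at the points `1/(d+1), 1, 1/2, 1/3, 1/m`. Its solutions are
tabulated in `orbitWeights`, and nonnegativity is checked case by case.

The degree is not larger because `p_6` receives a wrong value. Halving is harmless for even
functions. The means of monomials come from Gaussian integrals, and `⟨x,y⟩^10` is handled by
rotating `x` to a coordinate axis. -/

/-! ### Gaussian integrals and polar coordinates -/

open MeasureTheory in
-- In polar coordinates `f(rω) = r^k f(ω)`, so the integral is a product of a spherical and a radial
-- factor. This lets Gaussian integrals, which factor over the coordinates, compute integrals over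
-- the sphere.
theorem integral_homogeneous_mul_exp {n : ℕ} (hn : 0 < n) (k : ℕ)
    (f : EuclideanSpace ℝ (Fin n) → ℝ) (hf : ∀ (r : ℝ) x, 0 < r → f (r • x) = r ^ k * f x) :
    ∫ x, f x * Real.exp (-‖x‖ ^ 2) =
      (1 / 2 * Real.Gamma ((n + k : ℝ) / 2)) *
        ∫ y : Metric.sphere (0 : EuclideanSpace ℝ (Fin n)) 1, f y
          ∂(volume : Measure (EuclideanSpace ℝ (Fin n))).toSphere := by
  set μ : Measure (EuclideanSpace ℝ (Fin n)) := volume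
  have : Nonempty (Fin n) := ⟨⟨0, hn⟩⟩
  have hnt : Nontrivial (EuclideanSpace ℝ (Fin n)) := inferInstance
  have hdim : Module.finrank ℝ (EuclideanSpace ℝ (Fin n)) = n := by simp
  have hrad : ∫ r : Set.Ioi (0 : ℝ), (r : ℝ) ^ k * Real.exp (-(r : ℝ) ^ 2)
      ∂(Measure.volumeIoiPow (n - 1)) = 1 / 2 * Real.Gamma ((n + k : ℝ) / 2) := by
    -- The exponent collects `r^(n-1)` from the volume element and `r^k` from `f`.
    have h1 := integral_rpow_mul_exp_neg_rpow (p := 2) (q := (n - 1 + k : ℕ)) (by norm_num)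
      (by have : (0 : ℝ) ≤ (n - 1 + k : ℕ) := Nat.cast_nonneg _
          linarith)
    have h2 : (((n - 1 + k : ℕ) : ℝ) + 1) / 2 = (n + k : ℝ) / 2 := by
      obtain ⟨m, rfl⟩ : ∃ m, n = m + 1 := ⟨n - 1, by omega⟩
      push_cast [Nat.add_sub_cancel]; ring
    rw [h2] at h1
    rw [← h1]
    simp only [Measure.volumeIoiPow, ENNReal.ofReal]
    rw [integral_withDensity_eq_integral_smul (measurable_subtype_coe.pow_const _).real_toNNReal,
      integral_subtype_comap measurableSet_Ioi
        fun a ↦ Real.toNNReal (a ^ (n - 1)) • (a ^ k * Real.exp (-a ^ 2))]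
    refine setIntegral_congr_fun measurableSet_Ioi fun x hx ↦ ?_
    simp only [NNReal.smul_def, smul_eq_mul, Real.rpow_natCast]
    rw [Real.coe_toNNReal _ (pow_nonneg (le_of_lt hx) _), pow_add, mul_assoc]
    norm_num
  calc ∫ x, f x * Real.exp (-‖x‖ ^ 2) ∂μ
      -- Polar coordinates are defined off the origin, which is a null set.
      = ∫ x : ({(0)}ᶜ : Set (EuclideanSpace ℝ (Fin n))), f x * Real.exp (-‖x.1‖ ^ 2) ∂(μ.comap (↑)) := by
        rw [integral_subtype_comap (measurableSet_singleton _).compl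
          fun x ↦ f x * Real.exp (-‖x‖ ^ 2), restrict_compl_singleton]
    _ = ∫ z, f z.1 * ((z.2 : ℝ) ^ k * Real.exp (-(z.2 : ℝ) ^ 2))
          ∂μ.toSphere.prod (.volumeIoiPow (n - 1)) := by
        have h := μ.measurePreserving_homeomorphUnitSphereProd.integral_comp
          (Homeomorph.measurableEmbedding _)
          (fun z => f z.1 * ((z.2 : ℝ) ^ k * Real.exp (-(z.2 : ℝ) ^ 2)))
        rw [hdim] at h
        rw [← h]
        refine integral_congr_ae (.of_forall fun x => ?_)
        have hx : (x : EuclideanSpace ℝ (Fin n)) ≠ 0 := x.2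
        have hx' : 0 < ‖(x : EuclideanSpace ℝ (Fin n))‖ := norm_pos_iff.2 hx
        have h3 := hf ‖(x : EuclideanSpace ℝ (Fin n))‖ (‖(x : EuclideanSpace ℝ (Fin n))‖⁻¹ • (x : EuclideanSpace ℝ (Fin n))) hx'
        rw [smul_smul, mul_inv_cancel₀ hx'.ne', one_smul] at h3
        simp only [homeomorphUnitSphereProd_apply_snd_coe, homeomorphUnitSphereProd_apply_fst_coe]
        rw [h3]; ring
    _ = _ := by
        rw [integral_prod_mul (fun y : Metric.sphere (0 : EuclideanSpace ℝ (Fin n)) 1 => f y)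
          (fun r : Set.Ioi (0 : ℝ) => (r : ℝ) ^ k * Real.exp (-(r : ℝ) ^ 2)), hrad, mul_comm]

theorem Gamma_add_natCast (x : ℝ) (hx : 0 < x) (k : ℕ) :
    Real.Gamma (x + k) = (∏ j ∈ Finset.range k, (x + j)) * Real.Gamma x := by
  induction k with
  | zero => simp
  | succ k ih =>
    rw [Finset.prod_range_succ, Nat.cast_succ, ← add_assoc, Real.Gamma_add_one (by positivity), ih]
    ring

theorem integral_pow_even_mul_exp (k : ℕ) :
    ∫ t : ℝ, t ^ (2 * k) * Real.exp (-t ^ 2) =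
      (∏ j ∈ Finset.range k, (1 / 2 + (j : ℝ))) * Real.Gamma (1 / 2) := by
  have h1 := integral_rpow_mul_exp_neg_rpow (p := 2) (q := (2 * k : ℕ)) (by norm_num)
    (by have : (0 : ℝ) ≤ (2 * k : ℕ) := Nat.cast_nonneg _
        linarith)
  have h2 := integral_comp_abs (f := fun t : ℝ => t ^ (2 * k) * Real.exp (-t ^ 2))
  have h3 : (((2 * k : ℕ) : ℝ) + 1) / 2 = 1 / 2 + k := by push_cast; ring
  have h4 : ∀ t : ℝ, |t| ^ (2 * k) * Real.exp (-|t| ^ 2) = t ^ (2 * k) * Real.exp (-t ^ 2) := by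
    intro t
    rw [pow_mul, sq_abs, ← pow_mul]
  simp only [h4] at h2
  rw [h3, Gamma_add_natCast _ (by norm_num)] at h1
  simp only [Real.rpow_natCast, Real.rpow_ofNat] at h1
  rw [h2, h1]; ring

theorem integral_pow_odd_mul_exp (k : ℕ) (hk : Odd k) :
    ∫ t : ℝ, t ^ k * Real.exp (-t ^ 2) = 0 := by
  have h := MeasureTheory.integral_neg_eq_self (fun t : ℝ => t ^ k * Real.exp (-t ^ 2))
    MeasureTheory.volume
  simp only [hk.neg_pow, even_two.neg_pow, neg_mul, MeasureTheory.integral_neg] at h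
  linarith

open MeasureTheory in
theorem integral_monomial_mul_exp {n : ℕ} (α : Fin n → ℕ) :
    ∫ x : EuclideanSpace ℝ (Fin n), (∏ i, x i ^ α i) * Real.exp (-‖x‖ ^ 2) =
      ∏ i, ∫ t : ℝ, t ^ α i * Real.exp (-t ^ 2) := by
  rw [← integral_fintype_prod_volume_eq_prod (fun i (t : ℝ) => t ^ α i * Real.exp (-t ^ 2)),
    ← (PiLp.volume_preserving_toLp (Fin n)).integral_comp
      (MeasurableEquiv.toLp 2 (Fin n → ℝ)).measurableEmbedding]
  refine integral_congr_ae (.of_forall fun x => ?_)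
  simp only [EuclideanSpace.norm_sq_eq, Real.norm_eq_abs, sq_abs]
  rw [Finset.prod_mul_distrib, ← Real.exp_sum, Finset.sum_neg_distrib]

/-! ### Means of monomials over the sphere -/

namespace CubatureRule

theorem sphereMean_eq {n : ℕ} (f : EuclideanSpace ℝ (Fin n) → ℝ) :
    sphereMean f = (∫ y : Metric.sphere (0 : EuclideanSpace ℝ (Fin n)) 1, f y
        ∂(MeasureTheory.volume : MeasureTheory.Measure (EuclideanSpace ℝ (Fin n))).toSphere) /
      (∫ _ : Metric.sphere (0 : EuclideanSpace ℝ (Fin n)) 1, (1 : ℝ)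
        ∂(MeasureTheory.volume : MeasureTheory.Measure (EuclideanSpace ℝ (Fin n))).toSphere) := by
  rw [sphereMean, MeasureTheory.average_eq, MeasureTheory.integral_const, smul_eq_mul, smul_eq_mul,
    mul_one, div_eq_inv_mul]

theorem integral_exp_neg_norm_sq (n : ℕ) :
    ∫ x : EuclideanSpace ℝ (Fin n), Real.exp (-‖x‖ ^ 2) = Real.Gamma (1 / 2) ^ n := by
  have h := integral_monomial_mul_exp (fun _ : Fin n => 0)
  have h2 := integral_pow_even_mul_exp 0
  simp only [mul_zero, Finset.range_zero, Finset.prod_empty, one_mul, pow_zero,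
    Finset.prod_const_one] at h h2
  rw [h, h2]
  simp

/-- The mean of a homogeneous function in terms of its Gaussian integral. -/
theorem sphereMean_homogeneous {n : ℕ} (hn : 0 < n) (k : ℕ)
    (f : EuclideanSpace ℝ (Fin n) → ℝ) (hf : ∀ (r : ℝ) x, 0 < r → f (r • x) = r ^ k * f x) :
    sphereMean f = (∫ x, f x * Real.exp (-‖x‖ ^ 2)) * Real.Gamma (n / 2) /
      (Real.Gamma ((n + k : ℝ) / 2) * Real.Gamma (1 / 2) ^ n) := by
  have h0 := integral_homogeneous_mul_exp hn 0 (fun _ => 1) (by simp)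
  have h1 := integral_homogeneous_mul_exp hn k f hf
  simp only [one_mul, integral_exp_neg_norm_sq, Nat.cast_zero, add_zero] at h0
  have hn' : (0 : ℝ) < n := Nat.cast_pos.2 hn
  have g1 : Real.Gamma ((n + k : ℝ) / 2) ≠ 0 := (Real.Gamma_pos_of_pos (by positivity)).ne'
  have g2 : Real.Gamma ((n : ℝ) / 2) ≠ 0 := (Real.Gamma_pos_of_pos (by positivity)).ne'
  have g3 : Real.Gamma (1 / 2) ^ n ≠ 0 :=
    pow_ne_zero _ (Real.Gamma_pos_of_pos (by norm_num)).ne'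
  rw [sphereMean_eq, h1, h0]
  -- The case of the constant function writes the nonzero Gaussian integral as a multiple of the
  -- total mass of the sphere, so this mass is nonzero and may be cancelled.
  rw [h0] at g3
  have g4 := right_ne_zero_of_mul g3
  field_simp

theorem prod_coord_pow_smul {n : ℕ} (α : Fin n → ℕ) (r : ℝ) (x : EuclideanSpace ℝ (Fin n)) :
    ∏ i, (r • x) i ^ α i = r ^ (∑ i, α i) * ∏ i, x i ^ α i := by
  simp only [PiLp.smul_apply, smul_eq_mul, mul_pow, Finset.prod_mul_distrib,
    Finset.prod_pow_eq_pow_sum]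

theorem sphereMean_monomial_of_odd {n : ℕ} (α : Fin n → ℕ) (i : Fin n) (hi : Odd (α i)) :
    sphereMean (fun x : EuclideanSpace ℝ (Fin n) => ∏ i, x i ^ α i) = 0 := by
  rw [sphereMean_homogeneous (Fin.pos i) (∑ i, α i) _ (fun r x _ => prod_coord_pow_smul α r x),
    integral_monomial_mul_exp,
    Finset.prod_eq_zero (Finset.mem_univ i) (integral_pow_odd_mul_exp _ hi)]
  simp

theorem sphereMean_monomial_even {n : ℕ} (hn : 0 < n) (β : Fin n → ℕ) :
    sphereMean (fun x : EuclideanSpace ℝ (Fin n) => ∏ i, (x i ^ 2) ^ β i) =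
      (∏ i, ∏ j ∈ Finset.range (β i), (1 / 2 + (j : ℝ))) /
        ∏ j ∈ Finset.range (∑ i, β i), ((n : ℝ) / 2 + j) := by
  have hn' : (0 : ℝ) < n := Nat.cast_pos.2 hn
  simp only [← pow_mul]
  rw [sphereMean_homogeneous hn (∑ i, 2 * β i) _ (fun r x _ => prod_coord_pow_smul _ r x),
    integral_monomial_mul_exp]
  simp only [integral_pow_even_mul_exp, Finset.prod_mul_distrib, Finset.prod_const,
    Finset.card_univ, Fintype.card_fin]
  have h : ((n : ℝ) + (∑ i, 2 * β i : ℕ)) / 2 = n / 2 + (∑ i, β i : ℕ) := by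
    rw [← Finset.mul_sum]; push_cast; ring
  rw [h, Gamma_add_natCast _ (by positivity)]
  have g2 : Real.Gamma ((n : ℝ) / 2) ≠ 0 := (Real.Gamma_pos_of_pos (by positivity)).ne'
  have g3 : Real.Gamma (1 / 2) ≠ 0 := (Real.Gamma_pos_of_pos (by norm_num)).ne'
  have g4 : ∏ j ∈ Finset.range (∑ i, β i), ((n : ℝ) / 2 + j) ≠ 0 :=
    Finset.prod_ne_zero_iff.2 fun j _ => by positivity
  field_simp

/-- The mean of a homogeneous function is invariant under linear isometries. -/
theorem sphereMean_comp_isometry {n : ℕ} (hn : 0 < n) (k : ℕ)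
    (f : EuclideanSpace ℝ (Fin n) → ℝ) (hf : ∀ (r : ℝ) x, 0 < r → f (r • x) = r ^ k * f x)
    (e : EuclideanSpace ℝ (Fin n) ≃ₗᵢ[ℝ] EuclideanSpace ℝ (Fin n)) :
    sphereMean (fun x => f (e x)) = sphereMean f := by
  rw [sphereMean_homogeneous hn k f hf, sphereMean_homogeneous hn k (fun x => f (e x))
    (fun r x hr => by rw [map_smul, hf r _ hr])]
  congr 2
  simpa using e.measurePreserving.integral_comp e.toHomeomorph.measurableEmbedding
    (fun x => f x * Real.exp (-‖x‖ ^ 2))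

theorem integrable_sphere {n : ℕ} {f : EuclideanSpace ℝ (Fin n) → ℝ} (hf : Continuous f) :
    MeasureTheory.Integrable
      (fun y : Metric.sphere (0 : EuclideanSpace ℝ (Fin n)) 1 => f y)
      (MeasureTheory.volume : MeasureTheory.Measure (EuclideanSpace ℝ (Fin n))).toSphere :=
  (hf.comp continuous_subtype_val).integrable_of_hasCompactSupport
    (HasCompactSupport.of_compactSpace _)

theorem sphereMean_sum {n : ℕ} {ι : Type*} (s : Finset ι)
    (f : ι → EuclideanSpace ℝ (Fin n) → ℝ) (hf : ∀ i ∈ s, Continuous (f i)) :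
    sphereMean (fun x => ∑ i ∈ s, f i x) = ∑ i ∈ s, sphereMean (f i) := by
  simp only [sphereMean_eq, ← Finset.sum_div]
  rw [MeasureTheory.integral_finsetSum _ fun i hi => integrable_sphere (hf i hi)]

theorem sphereMean_const_mul {n : ℕ} (c : ℝ) (f : EuclideanSpace ℝ (Fin n) → ℝ) :
    sphereMean (fun x => c * f x) = c * sphereMean f := by
  simp only [sphereMean_eq, MeasureTheory.integral_const_mul, mul_div_assoc]

theorem sphereMean_congr {n : ℕ} {f g : EuclideanSpace ℝ (Fin n) → ℝ}
    (h : ∀ x, ‖x‖ = 1 → f x = g x) : sphereMean f = sphereMean g := by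
  rw [sphereMean, sphereMean]
  congr 1
  ext y
  exact h y (by simp)

end CubatureRule

/-! ### Signed permutations and the sizes of their orbits -/

section SignedPermutations

variable {n : ℕ}

@[simp]
theorem signedPerm_apply (σ : Equiv.Perm (Fin n)) (ε : Fin n → ℤˣ)
    (x : EuclideanSpace ℝ (Fin n)) (i : Fin n) :
    signedPerm σ ε x i = ((ε i : ℤ) : ℝ) * x (σ i) := rfl

theorem mem_orbitB {x y : EuclideanSpace ℝ (Fin n)} :
    y ∈ orbitB x ↔ ∃ σ ε, signedPerm σ ε x = y := by
  simp [orbitB]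

theorem signedPerm_signedPerm (σ τ : Equiv.Perm (Fin n)) (ε δ : Fin n → ℤˣ)
    (x : EuclideanSpace ℝ (Fin n)) :
    signedPerm σ ε (signedPerm τ δ x) = signedPerm (τ * σ) (fun i => ε i * δ (σ i)) x := by
  ext i
  simp [mul_assoc]

theorem signedPerm_inv_signedPerm (σ : Equiv.Perm (Fin n)) (ε : Fin n → ℤˣ)
    (x : EuclideanSpace ℝ (Fin n)) :
    signedPerm σ⁻¹ (fun i => ε (σ⁻¹ i)) (signedPerm σ ε x) = x := by
  ext i
  rcases Int.units_eq_one_or (ε (σ⁻¹ i)) with h | h <;>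
    simp only [signedPerm_apply, h] <;> simp

theorem signedPerm_injective (σ : Equiv.Perm (Fin n)) (ε : Fin n → ℤˣ) :
    Function.Injective (signedPerm σ ε) :=
  Function.LeftInverse.injective (signedPerm_inv_signedPerm σ ε)

theorem signedPerm_mem_orbitB_iff (σ : Equiv.Perm (Fin n)) (ε : Fin n → ℤˣ)
    {x y : EuclideanSpace ℝ (Fin n)} : signedPerm σ ε y ∈ orbitB x ↔ y ∈ orbitB x := by
  have key : ∀ σ ε (y : EuclideanSpace ℝ (Fin n)), y ∈ orbitB x → signedPerm σ ε y ∈ orbitB x := by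
    intro σ ε y hy
    obtain ⟨τ, δ, rfl⟩ := mem_orbitB.1 hy
    exact mem_orbitB.2 ⟨_, _, (signedPerm_signedPerm _ _ _ _ _).symm⟩
  refine ⟨fun h => ?_, key σ ε y⟩
  simpa only [signedPerm_inv_signedPerm] using key σ⁻¹ (fun i => ε (σ⁻¹ i)) _ h

theorem signedPerm_one_neg_one (x : EuclideanSpace ℝ (Fin n)) :
    signedPerm 1 (fun _ => -1) x = -x := by
  ext i
  simp

theorem units_cast_sq (u : ℤˣ) : ((u : ℤ) : ℝ) ^ 2 = 1 := by
  rcases Int.units_eq_one_or u with h | h <;> simp [h]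

theorem norm_signedPerm (σ : Equiv.Perm (Fin n)) (ε : Fin n → ℤˣ)
    (x : EuclideanSpace ℝ (Fin n)) : ‖signedPerm σ ε x‖ = ‖x‖ := by
  simp only [EuclideanSpace.norm_eq, signedPerm_apply, Real.norm_eq_abs, sq_abs, mul_pow,
    units_cast_sq, one_mul]
  rw [Equiv.sum_comp σ fun i => x i ^ 2]

theorem self_mem_orbitB (x : EuclideanSpace ℝ (Fin n)) : x ∈ orbitB x :=
  mem_orbitB.2 ⟨1, fun _ => 1, by ext i; simp⟩

/-- The size of an orbit, from a parametrization of the rearrangements of `x`. -/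
theorem card_orbitB {ι : Type*} (x : EuclideanSpace ℝ (Fin n)) (I : Finset ι)
    (z : ι → Fin n → ℝ) (hinj : Set.InjOn z I) (hnonneg : ∀ i ∈ I, ∀ j, 0 ≤ z i j) (k : ℕ)
    (hsupp : ∀ i ∈ I, (Finset.univ.filter fun j => z i j ≠ 0).card = k)
    (hz : ∀ w, (∃ i ∈ I, z i = w) ↔ ∃ σ : Equiv.Perm (Fin n), w = fun j => x (σ j)) :
    (orbitB x).card = I.card * 2 ^ k := by
  classical
  let S : ι → Finset (Fin n) := fun i => Finset.univ.filter fun j => z i j ≠ 0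
  -- A point of the orbit is encoded by its vector of absolute values together with the set of
  -- coordinates that are negated. That set is taken inside the support, since a sign at a zero
  -- coordinate is invisible; this gives the factor `2 ^ k`.
  let F : (Σ _ : ι, Finset (Fin n)) → EuclideanSpace ℝ (Fin n) :=
    fun q => WithLp.toLp 2 fun j => if j ∈ q.2 then -z q.1 j else z q.1 j
  have hF : orbitB x = (I.sigma fun i => (S i).powerset).image F := by
    ext y
    rw [mem_orbitB, Finset.mem_image]
    constructor
    · rintro ⟨σ, ε, rfl⟩
      obtain ⟨i, hi, hzi⟩ := (hz fun j => x (σ j)).2 ⟨σ, rfl⟩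
      refine ⟨⟨i, (S i).filter fun j => ε j = -1⟩, ?_, ?_⟩
      · simp [hi]
      · ext j
        have hj : x (σ j) = z i j := (congrFun hzi j).symm
        rcases Int.units_eq_one_or (ε j) with h | h
        · simp [F, h, hj]
        · by_cases h0 : z i j = 0 <;> simp [F, S, h, hj, h0]
    · rintro ⟨⟨i, T⟩, hT, rfl⟩
      obtain ⟨σ, hσ⟩ := (hz (z i)).1 ⟨i, (Finset.mem_sigma.1 hT).1, rfl⟩
      refine ⟨σ, fun j => if j ∈ T then -1 else 1, ?_⟩
      ext j
      have hj : z i j = x (σ j) := congrFun hσ j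
      by_cases h : j ∈ T <;> simp [F, h, hj]
  have hFinj : Set.InjOn F (I.sigma fun i => (S i).powerset) := by
    rintro ⟨i, T⟩ hT ⟨i', T'⟩ hT' h
    simp only [Finset.coe_sigma, Set.mem_sigma_iff, Finset.mem_coe, Finset.mem_powerset] at hT hT'
    have hval : ∀ j, (if j ∈ T then -z i j else z i j) = if j ∈ T' then -z i' j else z i' j :=
      fun j => congrArg (fun v : EuclideanSpace ℝ (Fin n) => v j) h
    -- Nonnegativity of `z` makes the absolute values determine the index.
    have hii : i = i' := by
      refine hinj hT.1 hT'.1 (funext fun j => ?_)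
      have h1 := hval j
      have h2 := hnonneg i hT.1 j
      have h3 := hnonneg i' hT'.1 j
      split_ifs at h1 <;> linarith
    subst hii
    congr 1
    ext j
    have h1 := hval j
    have hTj : j ∈ T → z i j ≠ 0 := fun hj => (Finset.mem_filter.1 (hT.2 hj)).2
    have hTj' : j ∈ T' → z i j ≠ 0 := fun hj => (Finset.mem_filter.1 (hT'.2 hj)).2
    by_cases h2 : j ∈ T <;> by_cases h3 : j ∈ T' <;> simp only [h2, h3, if_true, if_false] at h1 ⊢
    · exact (hTj h2 (by linarith)).elim
    · exact (hTj' h3 (by linarith)).elim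
  rw [hF, Finset.card_image_of_injOn hFinj, Finset.card_sigma,
    Finset.sum_congr rfl fun i hi => by rw [Finset.card_powerset, hsupp i hi], Finset.sum_const,
    smul_eq_mul]

theorem exists_perm_mem_iff {P Q : Finset (Fin n)} (h : P.card = Q.card) :
    ∃ σ : Equiv.Perm (Fin n), ∀ j, σ j ∈ Q ↔ j ∈ P := by
  let e : {j // j ∈ P} ≃ {j // j ∈ Q} := Fintype.equivOfCardEq (by simpa using h)
  refine ⟨e.extendSubtype, fun j => ⟨fun hj => ?_, fun hj => e.extendSubtype_mem j hj⟩⟩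
  by_contra hn
  exact e.extendSubtype_not_mem j hn hj

theorem card_orbitB_nodeV {k : ℕ} (hk : 1 ≤ k) (hkn : k ≤ n) :
    (orbitB (nodeV n k)).card = 2 ^ k * n.choose k := by
  set c := 1 / Real.sqrt (k : ℝ) with hc
  have hpos : 0 < c := by positivity
  have hcard : (Finset.univ.filter fun i : Fin n => (i : ℕ) < k).card = k := by
    simp [Fin.card_filter_val_lt, hkn]
  rw [card_orbitB (nodeV n k) (Finset.univ.powersetCard k)
    (fun (S : Finset (Fin n)) j => if j ∈ S then c else 0) _ _ k]
  · simp [mul_comm]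
  · intro S hS
    rw [← (Finset.mem_powersetCard.1 hS).2]
    congr 1
    ext j
    by_cases h : j ∈ S <;> simp [h, hpos.ne']
  · intro w
    constructor
    · rintro ⟨S, hS, rfl⟩
      obtain ⟨σ, hσ⟩ := exists_perm_mem_iff
        ((Finset.mem_powersetCard.1 hS).2.trans hcard.symm)
      refine ⟨σ, funext fun j => ?_⟩
      simp [nodeV, ← hσ j, hc]
    · rintro ⟨σ, rfl⟩
      refine ⟨Finset.univ.filter fun j => (σ j : ℕ) < k, ?_, ?_⟩
      · refine Finset.mem_powersetCard.2 ⟨Finset.subset_univ _, ?_⟩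
        refine Eq.trans ?_ hcard
        exact Finset.card_bij (fun j _ => σ j) (by simp) (by simp)
          fun i hi => ⟨σ.symm i, by simpa using hi, by simp⟩
      · funext j
        simp [nodeV, hc]
  · intro S _ T _ h
    ext j
    have := congrFun h j
    by_cases h1 : j ∈ S <;> by_cases h2 : j ∈ T <;> simp [h1, h2, hpos.ne, hpos.ne'] at this ⊢
  · intro S _ j
    split_ifs <;> positivity

/-- A rearrangement is given by the position of the special entry and a `p`-subset of the other
positions. Since `a ≠ 1`, the two nonzero values differ, so both can be read off from the point. -/
theorem card_orbitB_nodeU {d p : ℕ} {a : ℝ} (ha : 0 < a) (ha1 : a ≠ 1) (hp : 1 ≤ p) (hpd : p ≤ d) :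
    (orbitB (nodeU (d + 1) p a)).card = 2 ^ (p + 1) * (d + 1) * d.choose p := by
  set A := Real.sqrt (a / (a + p)) with hA
  set B := 1 / Real.sqrt (a + p) with hB
  have hA0 : 0 < A := by positivity
  have hB0 : 0 < B := by positivity
  have hAB : A ≠ B := by
    intro h
    have h2 : A ^ 2 = B ^ 2 := by rw [h]
    rw [hA, hB, Real.sq_sqrt (by positivity), div_pow, Real.sq_sqrt (by positivity)] at h2
    field_simp at h2
    exact ha1 (by linarith)
  have hcard : (Finset.univ.filter fun i : Fin (d + 1) => (i : ℕ) ≠ 0 ∧ (i : ℕ) ≤ p).card = p := by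
    have : (Finset.univ.filter fun i : Fin (d + 1) => (i : ℕ) ≠ 0 ∧ (i : ℕ) ≤ p) =
        (Finset.univ.filter fun i : Fin (d + 1) => (i : ℕ) < p + 1).erase 0 := by
      ext i
      simp only [Finset.mem_filter, Finset.mem_univ, true_and, Finset.mem_erase, ne_eq,
        Fin.ext_iff, Fin.val_zero]
      omega
    rw [this, Finset.card_erase_of_mem (by simp), Fin.card_filter_val_lt]
    omega
  rw [card_orbitB (nodeU (d + 1) p a)
    (Finset.univ.sigma fun i : Fin (d + 1) => (Finset.univ.erase i).powersetCard p)
    (fun q j => if j = q.1 then A else if j ∈ q.2 then B else 0) _ _ (p + 1)]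
  · simp [Finset.card_sigma]
    ring
  · rintro ⟨i, S⟩ hS
    simp only [Finset.mem_sigma, Finset.mem_univ, true_and, Finset.mem_powersetCard] at hS
    have hi : i ∉ S := fun h => by simpa using hS.1 h
    rw [← hS.2, ← Finset.card_insert_of_notMem hi]
    congr 1
    ext j
    by_cases h1 : j = i <;> by_cases h2 : j ∈ S <;> simp [h1, h2, hA0.ne', hB0.ne']
  · intro w
    constructor
    · rintro ⟨⟨i, S⟩, hS, rfl⟩
      simp only [Finset.mem_sigma, Finset.mem_univ, true_and, Finset.mem_powersetCard] at hS
      have hi : i ∉ S := fun h => by simpa using hS.1 h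
      obtain ⟨τ, hτ⟩ := exists_perm_mem_iff (hS.2.trans hcard.symm)
      simp only [Finset.mem_filter, Finset.mem_univ, true_and] at hτ
      -- `τ` carries `S` onto the positions `1, …, p`, so neither `τ i` nor `0` lies in that block;
      -- the swap sends `i` to position `0` without disturbing the block.
      refine ⟨Equiv.swap (τ i) 0 * τ, funext fun j => ?_⟩
      by_cases h1 : j = i
      · subst h1
        simp [nodeU, hA]
      · have h2 : τ j ≠ τ i := fun h => h1 (τ.injective h)
        by_cases h3 : τ j = 0
        · have h4 : j ∉ S := fun h => ((hτ j).2 h).1 (by simp [h3])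
          have h5 := mt (hτ i).1 hi
          have h6 : (τ i : ℕ) ≠ 0 := fun h => h2 (by rw [h3]; exact Fin.ext (by simp [h]))
          have h7 : ¬ ((τ i : ℕ) ≤ p) := fun h => h5 ⟨h6, h⟩
          have h8 : τ i ≠ 0 := fun h => h6 (by simp [h])
          simp [nodeU, h1, h4, h3, h7, h8]
        · have h6 : (τ j : ℕ) ≠ 0 := fun h => h3 (Fin.ext (by simp [h]))
          simp [nodeU, h1, Equiv.swap_apply_of_ne_of_ne h2 h3, ← hτ j, hB, h3]
    · rintro ⟨σ, rfl⟩
      refine ⟨⟨σ.symm 0, Finset.univ.filter fun j => (σ j : ℕ) ≠ 0 ∧ (σ j : ℕ) ≤ p⟩, ?_, ?_⟩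
      · simp only [Finset.mem_sigma, Finset.mem_univ, true_and, Finset.mem_powersetCard]
        refine ⟨fun j hj => ?_, ?_⟩
        · simp only [Finset.mem_filter, Finset.mem_univ, true_and] at hj
          refine Finset.mem_erase.2 ⟨?_, Finset.mem_univ _⟩
          rintro rfl
          exact hj.1 (by simp)
        · refine Eq.trans ?_ hcard
          exact Finset.card_bij (fun j _ => σ j) (by simp) (by simp)
            fun i hi => ⟨σ.symm i, by simpa using hi, by simp⟩
      · funext j
        by_cases h : σ j = 0
        · have h' : j = σ.symm 0 := by simp [← h]
          simp [nodeU, h', hA]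
        · have h' : j ≠ σ.symm 0 := fun h2 => h (by simp [h2])
          simp [nodeU, h, h', hB]
  · rintro ⟨i, S⟩ hS ⟨i', S'⟩ hS' h
    simp only [Finset.coe_sigma, Set.mem_sigma_iff, Finset.mem_coe, Finset.mem_univ, true_and,
      Finset.mem_powersetCard] at hS hS'
    have hi : i ∉ S := fun h => by simpa using hS.1 h
    have hi' : i' ∉ S' := fun h => by simpa using hS'.1 h
    have hii : i = i' := by
      by_contra hne
      have h1 := congrFun h i
      by_cases h2 : i ∈ S' <;> simp [hne, h2, hAB, hA0.ne'] at h1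
    subst hii
    congr 1
    ext j
    by_cases hj : j = i
    · subst hj
      simp [hi, hi']
    · have h1 := congrFun h j
      by_cases h2 : j ∈ S <;> by_cases h3 : j ∈ S' <;> simp [hj, h2, h3, hB0.ne, hB0.ne'] at h1 ⊢
  · rintro ⟨i, S⟩ _ j
    dsimp only
    split_ifs <;> positivity

end SignedPermutations

/-! ### Reduction of degree 11 to power sums, and antipodal halving -/

namespace CubatureRule

variable {n : ℕ}

theorem apply_comp_signedPerm {Q : CubatureRule n} (hQ : Q.IsInvariantB)
    (σ : Equiv.Perm (Fin n)) (ε : Fin n → ℤˣ) (f : EuclideanSpace ℝ (Fin n) → ℝ) :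
    Q.apply (fun x => f (signedPerm σ ε x)) = Q.apply f := by
  refine Finset.sum_bij (fun x _ => signedPerm σ ε x) (fun x hx => (hQ σ ε x hx).1)
    (fun x _ y _ h => signedPerm_injective σ ε h) (fun y hy => ?_)
    (fun x hx => by rw [(hQ σ ε x hx).2])
  refine ⟨_, (hQ σ⁻¹ (fun i => ε (σ⁻¹ i)) y hy).1, ?_⟩
  have h := signedPerm_inv_signedPerm σ⁻¹ (fun i => ε (σ⁻¹ i)) y
  simpa using h

theorem apply_sum {ι : Type*} (Q : CubatureRule n) (s : Finset ι)
    (f : ι → EuclideanSpace ℝ (Fin n) → ℝ) :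
    Q.apply (fun x => ∑ i ∈ s, f i x) = ∑ i ∈ s, Q.apply (f i) := by
  simp only [apply, Finset.mul_sum]
  exact Finset.sum_comm

theorem apply_const_mul (Q : CubatureRule n) (c : ℝ) (f : EuclideanSpace ℝ (Fin n) → ℝ) :
    Q.apply (fun x => c * f x) = c * Q.apply f := by
  simp only [apply, Finset.mul_sum]
  exact Finset.sum_congr rfl fun x _ => by ring

theorem apply_congr {Q : CubatureRule n} (hQ : Q.OnSphere)
    {f g : EuclideanSpace ℝ (Fin n) → ℝ} (h : ∀ x, ‖x‖ = 1 → f x = g x) :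
    Q.apply f = Q.apply g :=
  Finset.sum_congr rfl fun x hx => by rw [h x (hQ x hx)]

/-- The error of the rule on the monomial with exponents `2 * β i`. -/
noncomputable def evenError (Q : CubatureRule n) (β : Fin n → ℕ) : ℝ :=
  sphereMean (fun x : EuclideanSpace ℝ (Fin n) => ∏ i, (x i ^ 2) ^ β i) -
    Q.apply (fun x => ∏ i, (x i ^ 2) ^ β i)

theorem evenError_comp_perm (hn : 0 < n) {Q : CubatureRule n} (hQ : Q.IsInvariantB)
    (σ : Equiv.Perm (Fin n)) (β : Fin n → ℕ) :
    Q.evenError (fun i => β (σ i)) = Q.evenError β := by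
  rw [evenError, evenError, sphereMean_monomial_even hn, sphereMean_monomial_even hn,
    Equiv.sum_comp σ β, Equiv.prod_comp σ fun i => ∏ j ∈ Finset.range (β i), (1 / 2 + (j : ℝ)),
    ← apply_comp_signedPerm hQ σ⁻¹ (fun _ => 1) fun x => ∏ i, (x i ^ 2) ^ β i]
  congr 2
  funext x
  rw [← Equiv.prod_comp σ fun i => ((signedPerm σ⁻¹ (fun _ => 1) x) i ^ 2) ^ β i]
  simp

theorem continuous_evenMonomial (β : Fin n → ℕ) :
    Continuous fun x : EuclideanSpace ℝ (Fin n) => ∏ i, (x i ^ 2) ^ β i := by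
  fun_prop

theorem prod_sq_pow_add_single (β : Fin n → ℕ) (i : Fin n) (k : ℕ)
    (x : EuclideanSpace ℝ (Fin n)) :
    ∏ j, (x j ^ 2) ^ (β + Pi.single i k : Fin n → ℕ) j = (∏ j, (x j ^ 2) ^ β j) * (x i ^ 2) ^ k := by
  simp only [Pi.add_apply, pow_add, Finset.prod_mul_distrib]
  congr 1
  rw [Finset.prod_eq_single i (fun j _ hj => by simp [Pi.single_eq_of_ne hj]) (by simp)]
  simp

theorem sum_sq_of_norm_eq_one {x : EuclideanSpace ℝ (Fin n)} (hx : ‖x‖ = 1) :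
    ∑ i, x i ^ 2 = 1 := by
  have h := EuclideanSpace.norm_sq_eq x
  simp only [Real.norm_eq_abs, sq_abs] at h
  rw [← h, hx, one_pow]

/-- Multiplication by `∑ x_i² = 1` changes nothing on the sphere. The resulting linear relation
between errors in consecutive degrees is what eliminates exponents equal to 1. -/
theorem sum_evenError_add_single {Q : CubatureRule n} (hS : Q.OnSphere) (β : Fin n → ℕ) :
    ∑ i, Q.evenError (β + Pi.single i 1) = Q.evenError β := by
  simp only [evenError]
  rw [Finset.sum_sub_distrib, ← apply_sum, ← sphereMean_sum _ _
    fun i _ => continuous_evenMonomial _]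
  have key : ∀ x : EuclideanSpace ℝ (Fin n), ‖x‖ = 1 →
      ∑ i, ∏ j, (x j ^ 2) ^ (β + Pi.single i 1 : Fin n → ℕ) j = ∏ j, (x j ^ 2) ^ β j := by
    intro x hx
    simp only [prod_sq_pow_add_single, pow_one]
    rw [← Finset.mul_sum, sum_sq_of_norm_eq_one hx, mul_one]
  rw [sphereMean_congr key, apply_congr hS key]

theorem exists_perm_apply_pair {i j i' j' : Fin n} (h : i ≠ j) (h' : i' ≠ j') :
    ∃ σ : Equiv.Perm (Fin n), σ i = i' ∧ σ j = j' := by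
  refine ⟨Equiv.swap (Equiv.swap i i' j) j' * Equiv.swap i i', ?_, by simp⟩
  have h1 : i' ≠ Equiv.swap i i' j := fun h2 => h <| by
    have := congrArg (Equiv.swap i i') h2
    simpa using this
  simp [Equiv.swap_apply_of_ne_of_ne h1 h']

theorem single_comp_perm (σ : Equiv.Perm (Fin n)) (i : Fin n) (k : ℕ) :
    (fun t => (Pi.single (σ i) k : Fin n → ℕ) (σ t)) = Pi.single i k := by
  funext t
  by_cases h : t = i
  · subst h; simp
  · rw [Pi.single_eq_of_ne h, Pi.single_eq_of_ne fun h2 => h (σ.injective h2)]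

/-- The rule has the right value on the power sums of the squared coordinates that are needed
for degree 11. -/
structure PowerSumExact (Q : CubatureRule n) : Prop where
  zero : Q.evenError 0 = 0
  one : ∀ k ∈ Finset.Icc 2 5, ∑ i, Q.evenError (Pi.single i k) = 0
  two : ∀ k ∈ Finset.Icc 2 3,
    ∑ i, ∑ j, Q.evenError (Pi.single i k + Pi.single j 2) = 0

/-- By symmetry all terms of the vanishing sum are equal. -/
theorem PowerSumExact.single (hn : 0 < n) {Q : CubatureRule n} (hQ : Q.IsInvariantB)
    (h : Q.PowerSumExact) {k : ℕ} (hk : k ∈ Finset.Icc 2 5) (i : Fin n) :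
    Q.evenError (Pi.single i k) = 0 := by
  have h1 := h.one k hk
  have h2 : ∀ j ∈ Finset.univ, Q.evenError (Pi.single j k) = Q.evenError (Pi.single i k) := by
    intro j _
    rw [← evenError_comp_perm hn hQ (Equiv.swap j i) (Pi.single i k)]
    have := single_comp_perm (Equiv.swap j i) j k
    rw [Equiv.swap_apply_left] at this
    rw [this]
  rw [Finset.sum_congr rfl h2, Finset.sum_const, smul_eq_zero] at h1
  exact h1.resolve_left (by simp; omega)

/-- The diagonal terms of the double sum have the single exponent `k + 2 ≤ 5` and vanish by the
previous case; the `n (n - 1)` others are equal by symmetry. -/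
theorem PowerSumExact.pair (hn : 0 < n) {Q : CubatureRule n} (hQ : Q.IsInvariantB)
    (h : Q.PowerSumExact) {k : ℕ} (hk : k ∈ Finset.Icc 2 3) {i j : Fin n} (hij : i ≠ j) :
    Q.evenError (Pi.single i k + Pi.single j 2) = 0 := by
  classical
  have h1 := h.two k hk
  have h2 : ∀ i' j' : Fin n, Q.evenError (Pi.single i' k + Pi.single j' 2) =
      if i' = j' then 0 else Q.evenError (Pi.single i k + Pi.single j 2) := by
    intro i' j'
    split_ifs with h3
    · subst h3
      rw [← Pi.single_add]
      refine h.single hn hQ ?_ i'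
      simp only [Finset.mem_Icc] at hk ⊢
      omega
    · obtain ⟨σ, rfl, rfl⟩ := exists_perm_apply_pair h3 hij
      have e0 := evenError_comp_perm hn hQ σ
        (Pi.single (σ i') k + Pi.single (σ j') 2 : Fin n → ℕ)
      rw [← e0]
      have e1 := single_comp_perm σ i' k
      have e2 := single_comp_perm σ j' 2
      congr 1
      rw [← e1, ← e2]
      rfl
  have h3 : ∀ i' : Fin n, ∑ j', Q.evenError (Pi.single i' k + Pi.single j' 2) =
      ((n : ℝ) - 1) * Q.evenError (Pi.single i k + Pi.single j 2) := by
    intro i'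
    rw [Finset.sum_congr rfl fun j' _ => h2 i' j', ← Finset.sum_erase_add _ _ (Finset.mem_univ i'),
      Finset.sum_congr rfl fun j' hj' => if_neg (Finset.ne_of_mem_erase hj').symm,
      Finset.sum_const, Finset.card_erase_of_mem (Finset.mem_univ i')]
    simp [Nat.cast_sub (show 1 ≤ n from hn)]
  rw [Finset.sum_congr rfl fun i' _ => h3 i', Finset.sum_const, smul_eq_zero,
    mul_eq_zero] at h1
  have hn2 : (n : ℝ) - 1 ≠ 0 := by
    have h4 : n ≠ 1 := fun h4 => hij (Fin.ext (by omega))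
    rw [sub_ne_zero]
    exact_mod_cast h4
  exact (h1.resolve_left (by simp; omega)).resolve_left hn2

/-- Parts are at least 2 and sum to at most 5, so there are at most two of them. Taking `i` at a
maximum forces the second part to be 2. -/
theorem eq_single_add_of_ne_one (β : Fin n → ℕ) (hsum : ∑ i, β i ≤ 5) (h1 : ∀ i, β i ≠ 1) :
    β = 0 ∨ (∃ i, ∃ k ∈ Finset.Icc 2 5, β = Pi.single i k) ∨
      ∃ i j, i ≠ j ∧ ∃ k ∈ Finset.Icc 2 3, β = Pi.single i k + Pi.single j 2 := by
  by_cases h0 : β = 0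
  · exact Or.inl h0
  right
  have hne : (Finset.univ : Finset (Fin n)).Nonempty := by
    obtain ⟨i, _⟩ := Function.ne_iff.1 h0
    exact ⟨i, Finset.mem_univ i⟩
  obtain ⟨i, _, hi⟩ := Finset.exists_max_image Finset.univ β hne
  have hi2 : 2 ≤ β i := by
    obtain ⟨t, ht⟩ := Function.ne_iff.1 h0
    have := hi t (Finset.mem_univ t)
    have := h1 i
    simp only [Pi.zero_apply] at ht
    omega
  have hs1 := Finset.add_sum_erase Finset.univ β (Finset.mem_univ i)
  by_cases hj : ∃ j, j ≠ i ∧ β j ≠ 0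
  · obtain ⟨j, hji, hj0⟩ := hj
    have hs2 := Finset.add_sum_erase (Finset.univ.erase i) β
      (Finset.mem_erase.2 ⟨hji, Finset.mem_univ j⟩)
    have hj1 := h1 j
    have hij := hi j (Finset.mem_univ j)
    have hrest : ∀ t, t ≠ i → t ≠ j → β t = 0 := by
      intro t hti htj
      have := Finset.single_le_sum (f := β) (fun _ _ => Nat.zero_le _)
        (Finset.mem_erase.2 ⟨htj, Finset.mem_erase.2 ⟨hti, Finset.mem_univ t⟩⟩)
      have := h1 t
      omega
    refine Or.inr ⟨i, j, hji.symm, β i, Finset.mem_Icc.2 ⟨hi2, by omega⟩, funext fun t => ?_⟩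
    by_cases hti : t = i
    · subst hti; simp [Pi.single_eq_of_ne hji.symm]
    · by_cases htj : t = j
      · subst htj
        simp [Pi.single_eq_of_ne hti]
        omega
      · simp [Pi.single_eq_of_ne hti, Pi.single_eq_of_ne htj, hrest t hti htj]
  · push Not at hj
    refine Or.inl ⟨i, β i, Finset.mem_Icc.2 ⟨hi2, by omega⟩, funext fun t => ?_⟩
    by_cases hti : t = i
    · subst hti; simp
    · rw [Pi.single_eq_of_ne hti, hj t hti]

/-- Induction on the number of exponents equal to 1; with none left, the list of partitions applies.
-/
theorem PowerSumExact.evenError_eq_zero (hn : 0 < n) {Q : CubatureRule n} (hQ : Q.IsInvariantB)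
    (hS : Q.OnSphere) (h : Q.PowerSumExact) (β : Fin n → ℕ) (hβ : ∑ i, β i ≤ 5) :
    Q.evenError β = 0 := by
  classical
  induction hc : (Finset.univ.filter fun i => β i = 1).card using Nat.strong_induction_on
    generalizing β with
  | _ c ih =>
    subst hc
    by_cases hone : ∃ i, β i = 1
    · obtain ⟨i, hi⟩ := hone
      set γ : Fin n → ℕ := Function.update β i 0 with hγ
      have hγi : γ i = 0 := by simp [hγ]
      have hγt : ∀ t, t ≠ i → γ t = β t := fun t ht => by simp [hγ, ht]
      have hadd : γ + Pi.single i 1 = β := by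
        funext t
        by_cases ht : t = i
        · subst ht; simp [hγi, hi]
        · simp [hγt t ht, Pi.single_eq_of_ne ht]
      have hsum : ∀ t, ∑ s, (γ + Pi.single t 1 : Fin n → ℕ) s ≤ 5 := by
        intro t
        have h1 : ∀ t, ∑ s, (γ + Pi.single t 1 : Fin n → ℕ) s = ∑ s, γ s + 1 := fun t => by
          simp [Finset.sum_add_distrib]
        rw [h1, ← h1 i, hadd]
        exact hβ
      have hcard : (Finset.univ.filter fun s => γ s = 1).card <
          (Finset.univ.filter fun s => β s = 1).card := by
        refine Finset.card_lt_card ((Finset.ssubset_iff_of_subset ?_).2 ⟨i, by simp [hi], by simp [hγi]⟩)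
        intro s hs
        simp only [Finset.mem_filter, Finset.mem_univ, true_and] at hs ⊢
        rw [← hγt s fun h2 => by rw [h2, hγi] at hs; omega]
        exact hs
      -- In `∑_t E(γ + e_t) = E(γ)`, a position with `γ_t = 0` gives a permutation of `β`, while one
      -- with `γ_t ≥ 1` creates no new exponent 1, so induction applies. Hence the number of zeros
      -- of `γ` times `E(β)` is 0, and `i` is such a zero.
      have hterm : ∀ t, Q.evenError (γ + Pi.single t 1) =
          if γ t = 0 then Q.evenError β else 0 := by
        intro t
        split_ifs with ht
        · rw [← hadd, ← evenError_comp_perm hn hQ (Equiv.swap i t) (γ + Pi.single t 1)]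
          congr 1
          funext s
          have h2 := congrFun (single_comp_perm (Equiv.swap i t) i 1) s
          rw [Equiv.swap_apply_left] at h2
          simp only [Pi.add_apply]
          rw [h2]
          congr 1
          by_cases hs : s = i
          · subst hs; simp [ht, hγi]
          · by_cases hs2 : s = t
            · subst hs2; simp [ht, hγi]
            · rw [Equiv.swap_apply_of_ne_of_ne hs hs2]
        · refine ih _ (lt_of_le_of_lt (Finset.card_le_card fun s hs => ?_) hcard) _ (hsum t) rfl
          simp only [Finset.mem_filter, Finset.mem_univ, true_and, Pi.add_apply] at hs ⊢
          by_cases hst : s = t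
          · subst hst
            simp at hs
            omega
          · simpa [Pi.single_eq_of_ne hst] using hs
      have hγ0 : Q.evenError γ = 0 := by
        refine ih _ hcard γ ?_ rfl
        have := hsum i
        simp only [Pi.add_apply, Finset.sum_add_distrib] at this
        omega
      have h3 := sum_evenError_add_single hS γ
      rw [hγ0, Finset.sum_congr rfl fun t _ => hterm t, ← Finset.sum_filter, Finset.sum_const,
        smul_eq_zero] at h3
      refine h3.resolve_left fun h4 => ?_
      rw [Finset.card_eq_zero] at h4
      have : i ∈ Finset.univ.filter fun t => γ t = 0 := by simp [hγi]
      rw [h4] at this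
      simp at this
    · push Not at hone
      rcases eq_single_add_of_ne_one β hβ hone with rfl | ⟨i, k, hk, rfl⟩ | ⟨i, j, hij, k, hk, rfl⟩
      · exact h.zero
      · exact h.single hn hQ hk i
      · exact h.pair hn hQ hk hij

theorem PowerSumExact.isExactFor (hn : 0 < n) {Q : CubatureRule n} (hQ : Q.IsInvariantB)
    (hS : Q.OnSphere) (h : Q.PowerSumExact) (f : MvPolynomial (Fin n) ℝ)
    (hf : f.totalDegree ≤ 11) : Q.IsExactFor f := by
  have hmono : ∀ α ∈ f.support, sphereMean (fun x : EuclideanSpace ℝ (Fin n) => ∏ i, x i ^ α i) =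
      Q.apply fun x => ∏ i, x i ^ α i := by
    intro α hα
    by_cases hodd : ∃ i, Odd (α i)
    · obtain ⟨i, hi⟩ := hodd
      rw [sphereMean_monomial_of_odd _ i hi]
      -- Changing the sign of the coordinate with odd exponent negates the monomial but not the
      -- value of the rule.
      have h1 := apply_comp_signedPerm hQ 1 (Function.update (fun _ => 1) i (-1))
        fun x => ∏ i, x i ^ α i
      have h2 : ∀ x : EuclideanSpace ℝ (Fin n),
          ∏ j, (signedPerm 1 (Function.update (fun _ => 1) i (-1)) x) j ^ α j =
            (-1) * ∏ j, x j ^ α j := by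
        intro x
        rw [← Finset.mul_prod_erase Finset.univ (fun j => x j ^ α j) (Finset.mem_univ i),
          ← Finset.mul_prod_erase Finset.univ _ (Finset.mem_univ i), ← mul_assoc]
        congr 1
        · simp [hi.neg_pow]
        · refine Finset.prod_congr rfl fun j hj => ?_
          simp [Function.update_of_ne (Finset.ne_of_mem_erase hj)]
      simp only [h2] at h1
      rw [apply_const_mul] at h1
      linarith
    · push Not at hodd
      have heven : ∀ i, ∃ b, α i = 2 * b := fun i =>
        (Nat.not_odd_iff_even.1 (hodd i)).exists_two_nsmul
      choose β hβ using heven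
      have h1 : ∑ i, α i ≤ 11 := by
        refine le_trans (le_of_eq ?_) ((MvPolynomial.le_totalDegree hα).trans hf)
        rw [Finsupp.sum_fintype _ _ fun _ => rfl]
      -- Even exponents have even sum, so degree 11 costs no more than degree 10.
      have h2 : ∑ i, β i ≤ 5 := by
        simp only [hβ] at h1
        rw [← Finset.mul_sum] at h1
        omega
      have h3 := h.evenError_eq_zero hn hQ hS β h2
      simp only [hβ, pow_mul]
      exact sub_eq_zero.1 h3
  unfold IsExactFor
  simp only [MvPolynomial.eval_eq']
  rw [sphereMean_sum _ _ fun α _ => by fun_prop, apply_sum]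
  refine Finset.sum_congr rfl fun α hα => ?_
  rw [sphereMean_const_mul, apply_const_mul, hmono α hα]

theorem exists_isHalfOf {Q : CubatureRule n} (hQ : Q.IsInvariantB) (hS : Q.OnSphere) :
    ∃ Q' : CubatureRule n, Q'.IsHalfOf Q ∧
      ∀ f : EuclideanSpace ℝ (Fin n) → ℝ, (∀ x, f (-x) = f x) → Q'.apply f = Q.apply f := by
  classical
  have hneg : ∀ x ∈ Q.nodes, -x ∈ Q.nodes ∧ Q.weight (-x) = Q.weight x := fun x hx => by
    simpa only [signedPerm_one_neg_one] using hQ 1 (fun _ => -1) x hx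
  -- A well-ordering of the space selects one point of each antipodal pair; the two points differ
  -- because the nodes have norm 1.
  let R : EuclideanSpace ℝ (Fin n) → EuclideanSpace ℝ (Fin n) → Prop := WellOrderingRel
  have hR : ∀ x ∈ Q.nodes, (R (-x) x ↔ ¬ R x (-x)) := by
    intro x hx
    have hne : x ≠ -x := by
      intro h
      have h0 : x = 0 := by
        ext i
        have := congrArg (fun v : EuclideanSpace ℝ (Fin n) => v i) h
        simp only [PiLp.neg_apply] at this
        simp only [PiLp.zero_apply]
        linarith
      have := hS x hx
      rw [h0, norm_zero] at this
      exact zero_ne_one this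
    constructor
    · exact fun h1 h2 => asymm_of WellOrderingRel h1 h2
    · intro h1
      rcases trichotomous_of WellOrderingRel x (-x) with h2 | h2 | h2
      · exact (h1 h2).elim
      · exact (hne h2).elim
      · exact h2
  refine ⟨⟨Q.nodes.filter fun x => R (-x) x, fun x => 2 * Q.weight x⟩,
    ⟨Finset.filter_subset _ _, fun x hx => (hneg x hx).1, fun x hx => ?_, fun x _ => rfl⟩,
    fun f hf => ?_⟩
  · simp only [Finset.mem_filter, hx, (hneg x hx).1, true_and, neg_neg]
    exact hR x hx
  · have h1 : ∑ x ∈ Q.nodes.filter (fun x => ¬ R (-x) x), Q.weight x * f x =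
        ∑ x ∈ Q.nodes.filter (fun x => R (-x) x), Q.weight x * f x := by
      refine Finset.sum_bij (fun x _ => -x) (fun x hx => ?_) (fun x _ y _ h => neg_injective h)
        (fun x hx => ⟨-x, ?_, neg_neg x⟩) (fun x hx => ?_)
      · rw [Finset.mem_filter] at hx ⊢
        rw [neg_neg]
        refine ⟨(hneg x hx.1).1, ?_⟩
        by_contra h2
        exact hx.2 ((hR x hx.1).2 h2)
      · rw [Finset.mem_filter] at hx ⊢
        rw [neg_neg]
        exact ⟨(hneg x hx.1).1, (hR x hx.1).1 hx.2⟩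
      · rw [(hneg x (Finset.mem_filter.1 hx).1).2, hf]
    simp only [apply]
    rw [← Finset.sum_filter_add_sum_filter_not Q.nodes (fun x => R (-x) x), h1,
      ← Finset.sum_add_distrib]
    exact Finset.sum_congr rfl fun x _ => by ring

/-- A positive invariant rule that has the right value on the power sums of degree up to five in the
squared coordinates, but the wrong value on the one of degree six. -/
theorem PowerSumExact.isPositiveInvariantOfDegreeEleven (hn : 0 < n) {Q : CubatureRule n}
    (h : Q.PowerSumExact) (hS : Q.OnSphere) (hpos : Q.IsPositive) (hQ : Q.IsInvariantB)
    (h6 : ∑ i, Q.evenError (Pi.single i 6) ≠ 0) : Q.IsPositiveInvariantOfDegreeEleven := by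
  refine ⟨hS, hpos, hQ, ⟨h.isExactFor hn hQ hS, ?_⟩, ?_⟩
  · by_contra hcon
    push Not at hcon
    refine h6 (Finset.sum_eq_zero fun i _ => ?_)
    -- Exactness in degree 12 would make every `x_i^12`, and hence `p_6`, exact.
    have h1 := hcon (MvPolynomial.X i ^ 12) (by simp [MvPolynomial.totalDegree_X_pow])
    simp only [IsExactFor, map_pow, MvPolynomial.eval_X] at h1
    have h2 : ∀ x : EuclideanSpace ℝ (Fin n),
        ∏ j, (x j ^ 2) ^ (Pi.single i 6 : Fin n → ℕ) j = x i ^ 12 := by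
      intro x
      have := prod_sq_pow_add_single 0 i 6 x
      simp only [zero_add] at this
      rw [this]
      simp [← pow_mul]
    simp only [evenError, h2]
    exact sub_eq_zero.2 h1
  · obtain ⟨Q', hQ', happ⟩ := exists_isHalfOf hQ hS
    refine ⟨Q', hQ', fun x hx => hS x (hQ'.1 hx), fun x hx => ?_, fun f hf => ?_⟩
    · rw [hQ'.2.2.2 x hx]
      exact mul_pos two_pos (hpos x (hQ'.1 hx))
    · have h1 := h.isExactFor hn hQ hS f (hf.totalDegree_le.trans (by norm_num))
      rw [IsExactFor, happ _ fun x => ?_]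
      · exact h1
      · simp only [MvPolynomial.eval_eq']
        refine Finset.sum_congr rfl fun α hα => ?_
        -- A form of degree 10 is even, so halving leaves its value unchanged.
        have h2 : ∑ i, α i = 10 := by
          rw [← Finsupp.degree_eq_sum]
          by_contra h3
          exact MvPolynomial.mem_support_iff.1 hα (hf.coeff_eq_zero h3)
        have h3 := prod_coord_pow_smul (fun i => α i) (-1) x
        rw [h2, neg_one_smul] at h3
        rw [h3]
        norm_num

end CubatureRule

/-! ### Power sums at the generators and their means -/

/-- The rising factorial `x (x + 1) ⋯ (x + k - 1)`. -/
noncomputable def risingFactorial (x : ℝ) (k : ℕ) : ℝ := ∏ j ∈ Finset.range k, (x + j)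

/-- The `k`-th power sum of the squared coordinates. -/
def squarePowerSum {n : ℕ} (k : ℕ) (x : EuclideanSpace ℝ (Fin n)) : ℝ := ∑ i, (x i ^ 2) ^ k

theorem squarePowerSum_signedPerm {n : ℕ} (k : ℕ) (σ : Equiv.Perm (Fin n)) (ε : Fin n → ℤˣ)
    (x : EuclideanSpace ℝ (Fin n)) :
    squarePowerSum k (signedPerm σ ε x) = squarePowerSum k x := by
  simp only [squarePowerSum, signedPerm_apply, mul_pow, units_cast_sq, one_mul]
  rw [Equiv.sum_comp σ fun i => (x i ^ 2) ^ k]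

/-- The condition `k ≠ 0` is needed because `0 ^ 0 = 1` would count the vanishing coordinates too.
-/
theorem squarePowerSum_nodeV {n m k : ℕ} (hk : k ≠ 0) (hmn : m ≤ n) :
    squarePowerSum k (nodeV n m) = m * (1 / (m : ℝ)) ^ k := by
  have h : ∀ i : Fin n, (nodeV n m i ^ 2) ^ k =
      if (i : ℕ) < m then (1 / (m : ℝ)) ^ k else 0 := by
    intro i
    simp only [nodeV]
    split_ifs
    · rw [div_pow, Real.sq_sqrt (Nat.cast_nonneg _), one_pow]
    · simp [hk]
  rw [squarePowerSum, Finset.sum_congr rfl fun i _ => h i, ← Finset.sum_filter, Finset.sum_const,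
    Fin.card_filter_val_lt, min_eq_right hmn, nsmul_eq_mul]

theorem squarePowerSum_nodeU {d p k : ℕ} {a : ℝ} (ha : 0 < a) (hk : k ≠ 0) (hpd : p ≤ d) :
    squarePowerSum k (nodeU (d + 1) p a) = (a / (a + p)) ^ k + p * (1 / (a + p)) ^ k := by
  have hap : 0 ≤ a + p := by positivity
  have h : ∀ i : Fin d, (nodeU (d + 1) p a i.succ ^ 2) ^ k =
      if (i : ℕ) < p then (1 / (a + p)) ^ k else 0 := by
    intro i
    simp only [nodeU, Fin.val_succ, Nat.succ_ne_zero, if_false, Nat.succ_le_iff]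
    split_ifs
    · rw [div_pow, Real.sq_sqrt hap, one_pow]
    · simp [hk]
  have h0 : (nodeU (d + 1) p a 0 ^ 2) ^ k = (a / (a + p)) ^ k := by
    simp only [nodeU, Fin.val_zero, if_true]
    rw [Real.sq_sqrt (by positivity)]
  rw [squarePowerSum, Fin.sum_univ_succ, h0, Finset.sum_congr rfl fun i _ => h i,
    ← Finset.sum_filter, Finset.sum_const, Fin.card_filter_val_lt, min_eq_right hpd, nsmul_eq_mul]

namespace CubatureRule

variable {n : ℕ}

theorem sphereMean_single (hn : 0 < n) (i : Fin n) (k : ℕ) :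
    sphereMean (fun x : EuclideanSpace ℝ (Fin n) =>
      ∏ j, (x j ^ 2) ^ (Pi.single i k : Fin n → ℕ) j) =
      risingFactorial (1 / 2) k / risingFactorial (n / 2) k := by
  rw [sphereMean_monomial_even hn, Finset.sum_pi_single', if_pos (Finset.mem_univ i),
    Finset.prod_eq_single i (fun j _ hj => by simp [Pi.single_eq_of_ne hj]) (by simp),
    Pi.single_eq_same]
  rfl

theorem sphereMean_pair {i j : Fin n} (hij : i ≠ j) (k l : ℕ) :
    sphereMean (fun x : EuclideanSpace ℝ (Fin n) =>
      ∏ t, (x t ^ 2) ^ (Pi.single i k + Pi.single j l : Fin n → ℕ) t) =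
      risingFactorial (1 / 2) k * risingFactorial (1 / 2) l / risingFactorial (n / 2) (k + l) := by
  have hsum : ∑ t, (Pi.single i k + Pi.single j l : Fin n → ℕ) t = k + l := by
    simp [Finset.sum_add_distrib]
  rw [sphereMean_monomial_even (Fin.pos i), hsum,
    ← Finset.mul_prod_erase Finset.univ _ (Finset.mem_univ i),
    Finset.prod_eq_single_of_mem j (Finset.mem_erase.2 ⟨hij.symm, Finset.mem_univ j⟩)
      fun t ht htj => by simp [Pi.single_eq_of_ne htj, Pi.single_eq_of_ne (Finset.ne_of_mem_erase ht)]]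
  simp only [Pi.add_apply, Pi.single_eq_same, Pi.single_eq_of_ne hij, Pi.single_eq_of_ne hij.symm,
    add_zero, zero_add]
  rfl

theorem sum_evenError_single (hn : 0 < n) (Q : CubatureRule n) (k : ℕ) :
    ∑ i, Q.evenError (Pi.single i k) =
      n * (risingFactorial (1 / 2) k / risingFactorial (n / 2) k) -
        Q.apply (squarePowerSum k) := by
  simp only [evenError, sphereMean_single hn]
  rw [Finset.sum_sub_distrib, Finset.sum_const, ← apply_sum, nsmul_eq_mul, Finset.card_univ,
    Fintype.card_fin]
  congr 2
  funext x
  refine Finset.sum_congr rfl fun i _ => ?_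
  have := prod_sq_pow_add_single 0 i k x
  rw [zero_add] at this
  rw [this]
  simp

/-- The two mean terms are the `n` diagonal pairs and the `n (n - 1)` off-diagonal pairs in the
expansion of `p_k p_l`. -/
theorem sum_evenError_pair (hn : 0 < n) (Q : CubatureRule n) (k l : ℕ) :
    ∑ i, ∑ j, Q.evenError (Pi.single i k + Pi.single j l) =
      n * (risingFactorial (1 / 2) (k + l) / risingFactorial (n / 2) (k + l)) +
        n * (n - 1) * (risingFactorial (1 / 2) k * risingFactorial (1 / 2) l /
          risingFactorial (n / 2) (k + l)) -
        Q.apply (fun x => squarePowerSum k x * squarePowerSum l x) := by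
  have h1 : ∀ i : Fin n, ∑ j, sphereMean (fun x : EuclideanSpace ℝ (Fin n) =>
      ∏ t, (x t ^ 2) ^ (Pi.single i k + Pi.single j l : Fin n → ℕ) t) =
      risingFactorial (1 / 2) (k + l) / risingFactorial (n / 2) (k + l) +
        (n - 1) * (risingFactorial (1 / 2) k * risingFactorial (1 / 2) l /
          risingFactorial (n / 2) (k + l)) := by
    intro i
    rw [← Finset.add_sum_erase _ _ (Finset.mem_univ i), ← Pi.single_add, sphereMean_single hn,
      Finset.sum_congr rfl fun j hj => sphereMean_pair (Finset.ne_of_mem_erase hj).symm k l,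
      Finset.sum_const, Finset.card_erase_of_mem (Finset.mem_univ i)]
    simp [Nat.cast_sub (show 1 ≤ n from hn)]
  simp only [evenError, Finset.sum_sub_distrib, h1]
  rw [Finset.sum_const, nsmul_eq_mul, Finset.card_univ, Fintype.card_fin, mul_add, mul_assoc]
  congr 1
  simp only [← apply_sum]
  congr 1
  funext x
  rw [squarePowerSum, squarePowerSum, Finset.sum_mul_sum]
  refine Finset.sum_congr rfl fun i _ => Finset.sum_congr rfl fun j _ => ?_
  rw [prod_sq_pow_add_single]
  have := prod_sq_pow_add_single 0 i k x
  rw [zero_add] at this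
  rw [this]
  simp

end CubatureRule

/-! ### The six-orbit rule: from numerical equations to degree 11 -/

section SixOrbits

variable {d p m : ℕ} {a : ℝ} {lam : Fin 6 → ℝ}

/-- The parameters are in the range for which the six orbits are defined. -/
structure AdmissibleParameters (d p m : ℕ) (a : ℝ) : Prop where
  two_le_d : 2 ≤ d
  one_le_p : 1 ≤ p
  p_le_d : p ≤ d
  one_le_m : 1 ≤ m
  m_le : m ≤ d + 1
  a_pos : 0 < a
  a_ne_one : a ≠ 1

/-- The power sums of the squared coordinates of the six generators. -/
noncomputable def generatorPowerSum (d p m : ℕ) (a : ℝ) (k : ℕ) : Fin 6 → ℝ :=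
  ![((d : ℝ) + 1) * (1 / ((d : ℝ) + 1)) ^ k, 1, 2 * (1 / 2) ^ k, 3 * (1 / 3) ^ k,
    m * (1 / (m : ℝ)) ^ k, (a / (a + p)) ^ k + p * (1 / (a + p)) ^ k]

theorem AdmissibleParameters.squarePowerSum_generator (h : AdmissibleParameters d p m a)
    {k : ℕ} (hk : k ≠ 0) (j : Fin 6) :
    squarePowerSum k (generator d p m a j) = generatorPowerSum d p m a k j := by
  have := h.two_le_d
  fin_cases j
  · exact (squarePowerSum_nodeV hk le_rfl).trans (by simp [generatorPowerSum])
  · exact (squarePowerSum_nodeV hk (by omega)).trans (by simp [generatorPowerSum])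
  · exact (squarePowerSum_nodeV hk (by omega)).trans (by simp [generatorPowerSum])
  · exact (squarePowerSum_nodeV hk (by omega)).trans (by simp [generatorPowerSum])
  · exact squarePowerSum_nodeV hk h.m_le
  · exact squarePowerSum_nodeU h.a_pos hk h.p_le_d

theorem AdmissibleParameters.norm_generator (h : AdmissibleParameters d p m a) (j : Fin 6) :
    ‖generator d p m a j‖ = 1 := by
  have h1 : squarePowerSum 1 (generator d p m a j) = 1 := by
    rw [h.squarePowerSum_generator one_ne_zero]
    have hd : ((d : ℝ) + 1) ≠ 0 := by positivity
    have hm : (m : ℝ) ≠ 0 := by have := h.one_le_m; positivity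
    have hap : a + p ≠ 0 := by have := h.a_pos; positivity
    fin_cases j <;> simp [generatorPowerSum, hd, hm]
    field_simp
  have h2 := EuclideanSpace.norm_sq_eq (generator d p m a j)
  simp only [squarePowerSum, pow_one] at h1
  simp only [Real.norm_eq_abs, sq_abs, h1] at h2
  exact (pow_eq_one_iff_of_nonneg (norm_nonneg _) two_ne_zero).1 h2

theorem AdmissibleParameters.card_orbitB_generator (h : AdmissibleParameters d p m a)
    (j : Fin 6) : (orbitB (generator d p m a j)).card = orbitSize d p m j := by
  have := h.two_le_d
  fin_cases j
  · exact (card_orbitB_nodeV (by omega) le_rfl).trans (by simp [orbitSize])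
  · exact (card_orbitB_nodeV le_rfl (by omega)).trans (by simp [orbitSize])
  · exact card_orbitB_nodeV (by omega) (by omega)
  · exact card_orbitB_nodeV (by omega) (by omega)
  · exact card_orbitB_nodeV h.one_le_m h.m_le
  · exact card_orbitB_nodeU h.a_pos h.a_ne_one h.one_le_p h.p_le_d

theorem AdmissibleParameters.orbitSize_pos (h : AdmissibleParameters d p m a) (j : Fin 6) :
    (0 : ℝ) < orbitSize d p m j := by
  rw [← h.card_orbitB_generator j]
  exact_mod_cast Finset.card_pos.2 ⟨_, self_mem_orbitB _⟩

theorem mem_sixOrbitRule_nodes {x : EuclideanSpace ℝ (Fin (d + 1))} :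
    x ∈ (sixOrbitRule d p m a lam).nodes ↔ ∃ j, lam j ≠ 0 ∧ x ∈ orbitB (generator d p m a j) := by
  simp [sixOrbitRule]

/-- Adding the weights of coinciding nodes makes the rule split orbit by orbit even when orbits
coincide, as the first and fifth do for `d = 3`, `m = 4`. -/
theorem sixOrbitRule_apply (f : EuclideanSpace ℝ (Fin (d + 1)) → ℝ) :
    (sixOrbitRule d p m a lam).apply f =
      ∑ j, lam j / orbitSize d p m j * ∑ x ∈ orbitB (generator d p m a j), f x := by
  classical
  simp only [CubatureRule.apply]
  have h1 : ∀ x, (sixOrbitRule d p m a lam).weight x * f x =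
      ∑ j, if x ∈ orbitB (generator d p m a j) then lam j / orbitSize d p m j * f x else 0 := by
    intro x
    simp only [sixOrbitRule, Finset.sum_mul, ite_mul, zero_mul]
  rw [Finset.sum_congr rfl fun x _ => h1 x, Finset.sum_comm]
  refine Finset.sum_congr rfl fun j _ => ?_
  by_cases hj : lam j = 0
  · simp [hj]
  · rw [← Finset.sum_filter, Finset.mul_sum]
    refine Finset.sum_congr ?_ fun _ _ => rfl
    ext x
    rw [Finset.mem_filter, mem_sixOrbitRule_nodes]
    exact ⟨fun hx => hx.2, fun hx => ⟨⟨j, hj, hx⟩, hx⟩⟩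

/-- An invariant function is constant on orbits, and the normalisation by `orbitSize` is the true
cardinality. -/
theorem AdmissibleParameters.sixOrbitRule_apply_of_invariant (h : AdmissibleParameters d p m a)
    (f : EuclideanSpace ℝ (Fin (d + 1)) → ℝ) (hf : ∀ σ ε x, f (signedPerm σ ε x) = f x) :
    (sixOrbitRule d p m a lam).apply f = ∑ j, lam j * f (generator d p m a j) := by
  rw [sixOrbitRule_apply]
  refine Finset.sum_congr rfl fun j _ => ?_
  have h1 : ∀ x ∈ orbitB (generator d p m a j), f x = f (generator d p m a j) := by
    intro x hx
    obtain ⟨σ, ε, rfl⟩ := mem_orbitB.1 hx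
    exact hf σ ε _
  rw [Finset.sum_congr rfl h1, Finset.sum_const, h.card_orbitB_generator, nsmul_eq_mul, ← mul_assoc,
    div_mul_cancel₀ _ (h.orbitSize_pos j).ne']

theorem AdmissibleParameters.onSphere (h : AdmissibleParameters d p m a) :
    (sixOrbitRule d p m a lam).OnSphere := by
  intro x hx
  obtain ⟨j, _, hx⟩ := mem_sixOrbitRule_nodes.1 hx
  obtain ⟨σ, ε, rfl⟩ := mem_orbitB.1 hx
  rw [norm_signedPerm, h.norm_generator]

theorem AdmissibleParameters.isPositive (h : AdmissibleParameters d p m a)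
    (hlam : ∀ j, 0 ≤ lam j) : (sixOrbitRule d p m a lam).IsPositive := by
  intro x hx
  obtain ⟨j, hj, hx⟩ := mem_sixOrbitRule_nodes.1 hx
  simp only [sixOrbitRule]
  refine Finset.sum_pos' (fun i _ => ?_) ⟨j, Finset.mem_univ j, ?_⟩
  · split_ifs
    · exact div_nonneg (hlam i) (h.orbitSize_pos i).le
    · exact le_rfl
  · rw [if_pos hx]
    exact div_pos (lt_of_le_of_ne (hlam j) hj.symm) (h.orbitSize_pos j)

theorem sixOrbitRule_isInvariantB : (sixOrbitRule d p m a lam).IsInvariantB := by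
  intro σ ε x hx
  rw [mem_sixOrbitRule_nodes] at hx ⊢
  simp only [sixOrbitRule, signedPerm_mem_orbitB_iff]
  exact ⟨hx, trivial⟩

/-- The numerical conditions on the parameters that make the rule a positive rule of degree 11. -/
structure WeightEquations (d p m : ℕ) (a : ℝ) (lam : Fin 6 → ℝ) : Prop where
  nonneg : ∀ j, 0 ≤ lam j
  sum_eq_one : ∑ j, lam j = 1
  single : ∀ k ∈ Finset.Icc 2 5, ∑ j, lam j * generatorPowerSum d p m a k j =
    (d + 1) * (risingFactorial (1 / 2) k / risingFactorial ((d + 1) / 2) k)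
  pair : ∀ k ∈ Finset.Icc 2 3,
    ∑ j, lam j * (generatorPowerSum d p m a k j * generatorPowerSum d p m a 2 j) =
      (d + 1) * (risingFactorial (1 / 2) (k + 2) / risingFactorial ((d + 1) / 2) (k + 2)) +
        (d + 1) * d * (risingFactorial (1 / 2) k * risingFactorial (1 / 2) 2 /
          risingFactorial ((d + 1) / 2) (k + 2))
  six : ∑ j, lam j * generatorPowerSum d p m a 6 j ≠
    (d + 1) * (risingFactorial (1 / 2) 6 / risingFactorial ((d + 1) / 2) 6)

theorem AdmissibleParameters.apply_squarePowerSum (h : AdmissibleParameters d p m a)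
    {k : ℕ} (hk : k ≠ 0) : (sixOrbitRule d p m a lam).apply (squarePowerSum k) =
      ∑ j, lam j * generatorPowerSum d p m a k j := by
  rw [h.sixOrbitRule_apply_of_invariant _ (squarePowerSum_signedPerm k)]
  simp only [h.squarePowerSum_generator hk]

theorem WeightEquations.powerSumExact (h : AdmissibleParameters d p m a)
    (hw : WeightEquations d p m a lam) : (sixOrbitRule d p m a lam).PowerSumExact := by
  refine ⟨?_, fun k hk => ?_, fun k hk => ?_⟩
  · rw [CubatureRule.evenError, CubatureRule.sphereMean_monomial_even (Nat.succ_pos d)]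
    simp only [Pi.zero_apply, pow_zero, Finset.prod_const_one]
    rw [h.sixOrbitRule_apply_of_invariant (fun _ => 1) fun _ _ _ => rfl]
    simp [hw.sum_eq_one]
  · rw [CubatureRule.sum_evenError_single (Nat.succ_pos d),
      h.apply_squarePowerSum (by simp only [Finset.mem_Icc] at hk; omega), hw.single k hk]
    push_cast
    ring
  · rw [CubatureRule.sum_evenError_pair (Nat.succ_pos d), h.sixOrbitRule_apply_of_invariant _
      fun σ ε x => by rw [squarePowerSum_signedPerm, squarePowerSum_signedPerm]]
    have hk0 : k ≠ 0 := by simp only [Finset.mem_Icc] at hk; omega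
    simp only [h.squarePowerSum_generator hk0, h.squarePowerSum_generator two_ne_zero]
    rw [hw.pair k hk]
    push_cast
    ring

theorem WeightEquations.isPositiveInvariantOfDegreeEleven (h : AdmissibleParameters d p m a)
    (hw : WeightEquations d p m a lam) :
    (sixOrbitRule d p m a lam).IsPositiveInvariantOfDegreeEleven := by
  refine (hw.powerSumExact h).isPositiveInvariantOfDegreeEleven (Nat.succ_pos d) h.onSphere
    (h.isPositive hw.nonneg) sixOrbitRule_isInvariantB ?_
  rw [CubatureRule.sum_evenError_single (Nat.succ_pos d), h.apply_squarePowerSum (by norm_num),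
    sub_ne_zero]
  have := hw.six
  push_cast
  exact this.symm

theorem exists_rat_eq_div_sqrt_nodeV {n k : ℕ} (hk : 1 ≤ k) :
    ∃ r : ℚ, 0 < r ∧ ∀ i, ∃ b : ℚ, nodeV n k i = (b : ℝ) / Real.sqrt (r : ℝ) := by
  refine ⟨k, by exact_mod_cast hk, fun i => ⟨if (i : ℕ) < k then 1 else 0, ?_⟩⟩
  simp only [nodeV]
  split_ifs <;> simp

/-- Here `a = 4` matters: `√a = 2`, so the node is `(2, 1, …, 1, 0, …, 0) / √(4 + p)`. -/
theorem exists_rat_eq_div_sqrt_nodeU (n p : ℕ) :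
    ∃ r : ℚ, 0 < r ∧ ∀ i, ∃ b : ℚ, nodeU n p 4 i = (b : ℝ) / Real.sqrt (r : ℝ) := by
  refine ⟨4 + p, by positivity,
    fun i => ⟨if (i : ℕ) = 0 then 2 else if (i : ℕ) ≤ p then 1 else 0, ?_⟩⟩
  have h4 : Real.sqrt 4 = 2 := by
    rw [show (4 : ℝ) = 2 ^ 2 by norm_num, Real.sqrt_sq (by norm_num)]
  simp only [nodeU]
  split_ifs
  · rw [Real.sqrt_div (by norm_num), h4]
    push_cast
    rfl
  · simp
  · simp

theorem sixOrbitRule_isRational (hm : 1 ≤ m) (hlam : ∀ j, ∃ q : ℚ, lam j = (q : ℝ)) :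
    (sixOrbitRule d p m 4 lam).IsRational := by
  classical
  choose q hq using hlam
  intro x hx
  constructor
  · refine ⟨∑ j, if x ∈ orbitB (generator d p m 4 j) then q j / orbitSize d p m j else 0, ?_⟩
    simp only [sixOrbitRule, hq]
    rw [Rat.cast_sum]
    refine Finset.sum_congr rfl fun j _ => ?_
    split_ifs <;> simp
  · obtain ⟨j, _, hx⟩ := mem_sixOrbitRule_nodes.1 hx
    obtain ⟨σ, ε, rfl⟩ := mem_orbitB.1 hx
    have hgen : ∃ r : ℚ, 0 < r ∧ ∀ i, ∃ b : ℚ,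
        generator d p m 4 j i = (b : ℝ) / Real.sqrt (r : ℝ) := by
      fin_cases j
      · exact exists_rat_eq_div_sqrt_nodeV (Nat.succ_pos d)
      · exact exists_rat_eq_div_sqrt_nodeV le_rfl
      · exact exists_rat_eq_div_sqrt_nodeV (by norm_num)
      · exact exists_rat_eq_div_sqrt_nodeV (by norm_num)
      · exact exists_rat_eq_div_sqrt_nodeV hm
      · exact exists_rat_eq_div_sqrt_nodeU _ _
    obtain ⟨r, hr, hb⟩ := hgen
    refine ⟨r, hr, fun i => ?_⟩
    obtain ⟨b, hb⟩ := hb (σ i)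
    refine ⟨((ε i : ℤ) : ℚ) * b, ?_⟩
    rw [signedPerm_apply, hb]
    push_cast
    ring

end SixOrbits

/-! ### Schur's identity and powers of linear forms -/

set_option maxHeartbeats 1000000 in
theorem schurSum_eq (x : Fin 4 → ℝ) : schurSum x = 22680 * (∑ i, x i ^ 2) ^ 5 := by
  have h0 : Finset.Ioi (0 : Fin 4) = {1, 2, 3} := by decide
  have h1 : Finset.Ioi (1 : Fin 4) = {2, 3} := by decide
  have h2 : Finset.Ioi (2 : Fin 4) = {3} := by decide
  have h3 : Finset.Ioi (3 : Fin 4) = ∅ := by decide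
  have hs : ∀ f : ℤ → ℝ, ∑ ε ∈ ({1, -1} : Finset ℤ), f ε = f 1 + f (-1) := fun f =>
    Finset.sum_pair (by decide)
  -- Sums over erased sets become conditional sums over explicit indices, so that everything unfolds
  -- to a polynomial identity.
  have he : ∀ (i : Fin 4) (f : Fin 4 → ℝ), ∑ j ∈ Finset.univ.erase i, f j =
      ∑ j, if j ≠ i then f j else 0 := fun i f => by
    rw [← Finset.sum_filter]
    congr 1
    ext j
    simp
  have he2 : ∀ (i j : Fin 4) (f : Fin 4 → ℝ), ∑ k ∈ (Finset.Ioi j).erase i, f k =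
      ∑ k ∈ Finset.Ioi j, if k ≠ i then f k else 0 := fun i j f => by
    rw [← Finset.sum_filter]
    congr 1
    ext k
    simp [and_comm]
  simp only [schurSum, he, he2, hs, Fin.sum_univ_four, h0, h1, h2, h3]
  simp
  ring

/-- Since `x` and `‖x‖ e_i` have equal norms, a reflection carries one to the other, and by isometry
invariance only the mean of `y_i^(2k)` is needed. The coordinate `i` is arbitrary. -/
theorem CubatureRule.sphereMean_inner_pow {n : ℕ} (k : ℕ) (i : Fin n)
    (x : EuclideanSpace ℝ (Fin n)) :
    sphereMean (fun y => (inner ℝ x y) ^ (2 * k)) =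
      (∑ j, x j ^ 2) ^ k * (risingFactorial (1 / 2) k / risingFactorial (n / 2) k) := by
  have hn := Fin.pos i
  set w : EuclideanSpace ℝ (Fin n) := EuclideanSpace.single i ‖x‖ with hw
  have hnorm : ‖x‖ = ‖w‖ := by simp [hw]
  have he := Submodule.reflection_sub hnorm
  set e := Submodule.reflection (ℝ ∙ (x - w))ᗮ
  have h1 := sphereMean_comp_isometry hn (2 * k) (fun y => (inner ℝ w y) ^ (2 * k))
    (fun r y _ => by rw [inner_smul_right, mul_pow]) e
  have h2 : ∀ y, (inner ℝ w (e y) : ℝ) = inner ℝ x y := fun y => by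
    rw [← he, LinearIsometryEquiv.inner_map_map]
  have h3 : ∀ y : EuclideanSpace ℝ (Fin n), (inner ℝ w y : ℝ) ^ (2 * k) =
      (∑ j, x j ^ 2) ^ k * ∏ j, (y j ^ 2) ^ (Pi.single i k : Fin n → ℕ) j := by
    intro y
    have h4 := prod_sq_pow_add_single 0 i k y
    rw [zero_add] at h4
    have h5 := EuclideanSpace.norm_sq_eq x
    simp only [Real.norm_eq_abs, sq_abs] at h5
    rw [h4, ← h5, hw, EuclideanSpace.inner_single_left]
    simp
    ring
  simp only [h2] at h1
  rw [h1]
  simp only [h3]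
  rw [sphereMean_const_mul, sphereMean_single hn]

theorem CubatureRule.apply_inner_pow {n k t : ℕ} {Q : CubatureRule n}
    (hQ : Q.IsOfDegree t) (hk : 2 * k ≤ t) (i : Fin n) (x : EuclideanSpace ℝ (Fin n)) :
    Q.apply (fun y => (inner ℝ x y) ^ (2 * k)) =
      (∑ j, x j ^ 2) ^ k * (risingFactorial (1 / 2) k / risingFactorial (n / 2) k) := by
  have h := hQ.1 ((∑ j, MvPolynomial.C (x j) * MvPolynomial.X j) ^ (2 * k)) (by
    refine (MvPolynomial.totalDegree_pow _ _).trans (le_trans ?_ hk)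
    refine (Nat.mul_le_mul_left _ ?_).trans_eq (mul_one _)
    refine MvPolynomial.totalDegree_finsetSum_le fun j _ => ?_
    refine (MvPolynomial.totalDegree_mul _ _).trans ?_
    simp)
  have h1 : ∀ y : EuclideanSpace ℝ (Fin n),
      MvPolynomial.eval (fun j => y j)
        ((∑ j, MvPolynomial.C (x j) * MvPolynomial.X j) ^ (2 * k)) =
      (inner ℝ x y) ^ (2 * k) := by
    intro y
    simp [PiLp.inner_apply, mul_comm]
  simp only [IsExactFor, h1] at h
  rw [← h, sphereMean_inner_pow k i]

/-! ### Explicit weights and their verification -/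

/-- The weights of the six orbits for each of the dimensions `3 ≤ d ≤ 23`. -/
def orbitWeights : ℕ → Fin 6 → ℚ
  | 3 => ![2/15, 1/15, 1/8, 0, 0, 27/40]
  | 4 => ![625/9009, 860/27027, 1088/9009, 2700/17017, 40448/441441, 913952/1731807]
  | 5 => ![27/280, 19/840, 1/14, 27/896, 16/189, 2401/3456]
  | 6 => ![2401/28080, 805/61776, 136/2145, 135/2288, 3968/19305, 6561/11440]
  | 7 => ![32/315, 1/105, 2/45, 0, 2/15, 32/45]
  | 8 => ![277749/4108390, 886833/143793650, 17216/560235, 159516/2054195, 926625/4519229,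
      85525504/139564425]
  | 9 => ![625/7056, 47/10080, 1/42, 27/784, 625/5376, 6561/8960]
  | 10 => ![638391523/7933086720, 18884159/5949815040, 31726/1549431, 6325047/176290816,
      27731875/132218112, 81450625/125259264]
  | 11 => ![13/147, 361/145152, 143/9072, 55/2688, 116875/1016064, 6875/9072]
  | 12 => ![806591201/9598758960, 91489081/52793174280, 9510176/599922435, 3142557/399948290,
      22928125/112926576, 4408992/6413165]
  | 13 => ![2401/29040, 421/295680, 13/1188, 351/30976, 8125/76032, 190333/241920]
  | 14 => ![118869375/1912878352, 276450313/248674185760, 300044/51237813, 8664903/273268336,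
      14873196/85396355, 671898241/926736096]
  | 15 => ![1024/14157, 1/1152, 1/132, 63/9152, 4375/46464, 9/11]
  | 16 => ![9437873/164038875, 93134/134213625, 65792/14912625, 864/43225, 1206144/7811375,
      819200/1073709]
  | 17 => ![21627/371800, 4201/7413120, 17/3510, 357/57200, 252875/3212352, 485537/570240]
  | 18 => ![1717239817/35935972800, 3330379/7342686750, 9456/2879485, 483327/36857408,
      125428176/935832625, 31381059609/39160996000]
  | 19 => ![6250/153153, 129/320320, 19/8008, 4617/544544, 11875/192192, 45619/51480]
  | 20 => ![73489808/2163331125, 18522391/58974287625, 5125936/2336397615, 845386/86533245,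
      81961136/721110375, 2829124000/3367635183]
  | 21 => ![14641/705432, 61/192192, 0, 405/31616, 625/14144, 16875/18304]
  | 22 => ![71527079759/4245415664400, 1232770879/5244336997200, 16210172/15608145825,
      83019783/9249271600, 36838956/393094043, 148733980571/169172161200]
  | 23 => ![0, 1/4095, 0, 0, 506/12285, 11776/12285]
  | _ => 0

theorem admissibleParameters_of_mem {d p m : ℕ} (h : (d, p, m) ∈ parameters) :
    AdmissibleParameters d p m (parameterA d p) := by
  simp only [parameters, List.mem_cons, Prod.mk.injEq, List.not_mem_nil, or_false] at h
  rcases h with ⟨rfl, rfl, rfl⟩ | ⟨rfl, rfl, rfl⟩ | ⟨rfl, rfl, rfl⟩ | ⟨rfl, rfl, rfl⟩ |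
    ⟨rfl, rfl, rfl⟩ | ⟨rfl, rfl, rfl⟩ | ⟨rfl, rfl, rfl⟩ | ⟨rfl, rfl, rfl⟩ | ⟨rfl, rfl, rfl⟩ |
    ⟨rfl, rfl, rfl⟩ | ⟨rfl, rfl, rfl⟩ | ⟨rfl, rfl, rfl⟩ | ⟨rfl, rfl, rfl⟩ | ⟨rfl, rfl, rfl⟩ |
    ⟨rfl, rfl, rfl⟩ | ⟨rfl, rfl, rfl⟩ | ⟨rfl, rfl, rfl⟩ | ⟨rfl, rfl, rfl⟩ | ⟨rfl, rfl, rfl⟩ |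
    ⟨rfl, rfl, rfl⟩ | ⟨rfl, rfl, rfl⟩
  all_goals constructor <;> norm_num [parameterA]

set_option maxHeartbeats 4000000 in
-- After `λ_6` is fixed, the remaining moments `∑ λ_j k_j^(-s)`, `0 ≤ s ≤ 4`, with `k_j` the numbers
-- `d + 1, 1, 2, 3, m`, determine the table uniquely when these are distinct. For `d = 3` one has `d
-- + 1 = m`, only `λ_1 + λ_5` matters, and the table takes `λ_5 = 0`. Everything is exact rational
-- arithmetic.
theorem orbitWeights_equations {d p m : ℕ} (h : (d, p, m) ∈ parameters) :
    WeightEquations d p m (parameterA d p) (fun j => (orbitWeights d j : ℝ)) := by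
  simp only [parameters, List.mem_cons, Prod.mk.injEq, List.not_mem_nil, or_false] at h
  rcases h with ⟨rfl, rfl, rfl⟩ | ⟨rfl, rfl, rfl⟩ | ⟨rfl, rfl, rfl⟩ | ⟨rfl, rfl, rfl⟩ |
    ⟨rfl, rfl, rfl⟩ | ⟨rfl, rfl, rfl⟩ | ⟨rfl, rfl, rfl⟩ | ⟨rfl, rfl, rfl⟩ | ⟨rfl, rfl, rfl⟩ |
    ⟨rfl, rfl, rfl⟩ | ⟨rfl, rfl, rfl⟩ | ⟨rfl, rfl, rfl⟩ | ⟨rfl, rfl, rfl⟩ | ⟨rfl, rfl, rfl⟩ |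
    ⟨rfl, rfl, rfl⟩ | ⟨rfl, rfl, rfl⟩ | ⟨rfl, rfl, rfl⟩ | ⟨rfl, rfl, rfl⟩ | ⟨rfl, rfl, rfl⟩ |
    ⟨rfl, rfl, rfl⟩ | ⟨rfl, rfl, rfl⟩
  all_goals
    constructor
    · intro j
      fin_cases j <;> norm_num [orbitWeights]
    · norm_num [orbitWeights, Fin.sum_univ_succ]
    · intro k hk
      fin_cases hk <;> norm_num [orbitWeights, Fin.sum_univ_succ, generatorPowerSum, parameterA,
        risingFactorial, Finset.prod_range_succ]
    · intro k hk
      fin_cases hk <;> norm_num [orbitWeights, Fin.sum_univ_succ, generatorPowerSum, parameterA,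
        risingFactorial, Finset.prod_range_succ]
    · norm_num [orbitWeights, Fin.sum_univ_succ, generatorPowerSum, parameterA, risingFactorial,
        Finset.prod_range_succ]

/-- The formula is the mean of `p_1 p_4 - p_2 p_3` over the sphere, `60 d / ((d+3)(d+5)(d+7)(d+9))`,
divided by its value `p a (a-1)² (a+1) / (a+p)^5` at `u`; here it is checked case by case. -/
theorem orbitWeights_five {d p m : ℕ} (h : (d, p, m) ∈ parameters) :
    (orbitWeights d 5 : ℝ) = (parameterA d p + p) ^ 5 *
      (60 * d / (p * parameterA d p * (parameterA d p - 1) ^ 2 * (parameterA d p + 1) *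
        (d + 9) * (d + 7) * (d + 5) * (d + 3))) := by
  simp only [parameters, List.mem_cons, Prod.mk.injEq, List.not_mem_nil, or_false] at h
  rcases h with ⟨rfl, rfl, rfl⟩ | ⟨rfl, rfl, rfl⟩ | ⟨rfl, rfl, rfl⟩ | ⟨rfl, rfl, rfl⟩ |
    ⟨rfl, rfl, rfl⟩ | ⟨rfl, rfl, rfl⟩ | ⟨rfl, rfl, rfl⟩ | ⟨rfl, rfl, rfl⟩ | ⟨rfl, rfl, rfl⟩ |
    ⟨rfl, rfl, rfl⟩ | ⟨rfl, rfl, rfl⟩ | ⟨rfl, rfl, rfl⟩ | ⟨rfl, rfl, rfl⟩ | ⟨rfl, rfl, rfl⟩ |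
    ⟨rfl, rfl, rfl⟩ | ⟨rfl, rfl, rfl⟩ | ⟨rfl, rfl, rfl⟩ | ⟨rfl, rfl, rfl⟩ | ⟨rfl, rfl, rfl⟩ |
    ⟨rfl, rfl, rfl⟩ | ⟨rfl, rfl, rfl⟩
  all_goals
    simp only [orbitWeights, Matrix.cons_val]
    norm_num [parameterA]

theorem two_mul_eq_of_odd {d p m : ℕ} (h : (d, p, m) ∈ parameters) (hd : Odd d) :
    d + 1 = 2 * p := by
  have key : ∀ q ∈ parameters, q.1 % 2 = 1 → q.1 + 1 = 2 * q.2.1 := by decide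
  exact key _ h (Nat.odd_iff.1 hd)

theorem parameterA_eq_four {d p : ℕ} (hd : 2 ≤ d) (h : d + 1 = 2 * p) : parameterA d p = 4 := by
  have h1 : (d : ℝ) + 1 = 2 * p := by exact_mod_cast h
  have h2 : (2 : ℝ) ≤ d := by exact_mod_cast hd
  have h3 : (d : ℝ) - 1 ≠ 0 := by linarith
  rw [parameterA, show (p : ℝ) - 1 = (d - 1) / 2 by linarith]
  field_simp
  norm_num

/-- The rule with weights `orbitWeights` when `d = 2 p - 1`. -/
theorem sixOrbitRule_of_two_mul_eq {d p m : ℕ} (h : (d, p, m) ∈ parameters) (hdp : d + 1 = 2 * p)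
    {lam : Fin 6 → ℝ} (hlam : ∀ j, lam j = orbitWeights d j) :
    (sixOrbitRule d p m 4 lam).IsPositiveInvariantOfDegreeEleven ∧
      (sixOrbitRule d p m 4 lam).IsRational := by
  obtain rfl : lam = fun j => (orbitWeights d j : ℝ) := funext hlam
  have hadm := admissibleParameters_of_mem h
  have hw := orbitWeights_equations h
  rw [parameterA_eq_four hadm.two_le_d hdp] at hadm hw
  exact ⟨hw.isPositiveInvariantOfDegreeEleven hadm,
    sixOrbitRule_isRational hadm.one_le_m fun j => ⟨_, rfl⟩⟩

theorem mainTheorem8 :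
    (∀ d : ℕ, 3 ≤ d → d ≤ 23 → ∃ p m : ℕ, (d, p, m) ∈ parameters) ∧
    (∀ d p m : ℕ, (d, p, m) ∈ parameters →
      0 < parameterA d p ∧ parameterA d p ≠ 1 ∧
      (Odd d → d + 1 = 2 * p) ∧
      (d + 1 = 2 * p → parameterA d p = 4) ∧
      ∃ lam : Fin 6 → ℝ,
        (∀ j, 0 ≤ lam j) ∧ ∑ j, lam j = 1 ∧
        lam 5 = (parameterA d p + p) ^ 5 *
          (60 * d / (p * parameterA d p * (parameterA d p - 1) ^ 2 * (parameterA d p + 1) *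
            (d + 9) * (d + 7) * (d + 5) * (d + 3))) ∧
        (sixOrbitRule d p m (parameterA d p) lam).IsPositiveInvariantOfDegreeEleven ∧
        (d + 1 = 2 * p → (∀ j, ∃ q : ℚ, lam j = (q : ℝ)) ∧
          (sixOrbitRule d p m (parameterA d p) lam).IsRational)) ∧
    (sixOrbitRule 3 2 4 4
      ![2 / 15, 1 / 15, 1 / 8, 0, 0, 27 / 40]).IsPositiveInvariantOfDegreeEleven ∧
    (sixOrbitRule 3 2 4 4 ![2 / 15, 1 / 15, 1 / 8, 0, 0, 27 / 40]).IsRational ∧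
    (sixOrbitRule 7 4 4 4
      ![32 / 315, 1 / 105, 2 / 45, 0, 2 / 15, 32 / 45]).IsPositiveInvariantOfDegreeEleven ∧
    (sixOrbitRule 7 4 4 4 ![32 / 315, 1 / 105, 2 / 45, 0, 2 / 15, 32 / 45]).IsRational ∧
    (sixOrbitRule 21 11 5 4
      ![14641 / 705432, 61 / 192192, 0, 405 / 31616, 625 / 14144,
        16875 / 18304]).IsPositiveInvariantOfDegreeEleven ∧
    (sixOrbitRule 21 11 5 4
      ![14641 / 705432, 61 / 192192, 0, 405 / 31616, 625 / 14144, 16875 / 18304]).IsRational ∧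
    (sixOrbitRule 23 12 4 4
      ![0, 1 / 4095, 0, 0, 506 / 12285, 11776 / 12285]).IsPositiveInvariantOfDegreeEleven ∧
    (sixOrbitRule 23 12 4 4 ![0, 1 / 4095, 0, 0, 506 / 12285, 11776 / 12285]).IsRational ∧
    (∀ x : EuclideanSpace ℝ (Fin 4),
      22680 * (∑ i, x i ^ 2) ^ 5 =
        552960 * (sixOrbitRule 3 2 4 4 ![2 / 15, 1 / 15, 1 / 8, 0, 0, 27 / 40]).apply
          (fun y => (inner ℝ x y) ^ 10) ∧
      22680 * (∑ i, x i ^ 2) ^ 5 = schurSum (fun i => x i)) := by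
  have h3 := sixOrbitRule_of_two_mul_eq (d := 3) (p := 2) (m := 4) (by decide) rfl
    (lam := ![2 / 15, 1 / 15, 1 / 8, 0, 0, 27 / 40])
    fun j => by fin_cases j <;> norm_num [orbitWeights]
  have h7 := sixOrbitRule_of_two_mul_eq (d := 7) (p := 4) (m := 4) (by decide) rfl
    (lam := ![32 / 315, 1 / 105, 2 / 45, 0, 2 / 15, 32 / 45])
    fun j => by fin_cases j <;> norm_num [orbitWeights]
  have h21 := sixOrbitRule_of_two_mul_eq (d := 21) (p := 11) (m := 5) (by decide) rfl
    (lam := ![14641 / 705432, 61 / 192192, 0, 405 / 31616, 625 / 14144, 16875 / 18304])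
    fun j => by fin_cases j <;> norm_num [orbitWeights]
  have h23 := sixOrbitRule_of_two_mul_eq (d := 23) (p := 12) (m := 4) (by decide) rfl
    (lam := ![0, 1 / 4095, 0, 0, 506 / 12285, 11776 / 12285])
    fun j => by fin_cases j <;> norm_num [orbitWeights]
  refine ⟨fun d hd1 hd2 => by interval_cases d <;> simp [parameters],
    fun d p m h => ?_, h3.1, h3.2, h7.1, h7.2, h21.1, h21.2, h23.1, h23.2,
    fun x => ⟨?_, (schurSum_eq fun i => x i).symm⟩⟩
  · have hadm := admissibleParameters_of_mem h
    have hw := orbitWeights_equations h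
    refine ⟨hadm.a_pos, hadm.a_ne_one, two_mul_eq_of_odd h, parameterA_eq_four hadm.two_le_d,
      fun j => (orbitWeights d j : ℝ), hw.nonneg, hw.sum_eq_one, orbitWeights_five h,
      hw.isPositiveInvariantOfDegreeEleven hadm, fun hdp => ⟨fun j => ⟨_, rfl⟩, ?_⟩⟩
    rw [parameterA_eq_four hadm.two_le_d hdp]
    exact (sixOrbitRule_of_two_mul_eq h hdp fun _ => rfl).2
  · have h := CubatureRule.apply_inner_pow (k := 5) h3.1.2.2.2.1 (by norm_num) 0 x
    norm_num at h
    rw [h]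
    -- For `n = 4` and `k = 5` the quotient of rising factorials is `21/512`, and `552960 · 21/512 =
    -- 22680`.
    norm_num [risingFactorial, Finset.prod_range_succ]
    ring
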